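/- Let $G$ be a locally compact second countable (Hausdorff) group. All probability spaces are standard Borel, and a p.m.p. action $G\curvearrowright(X,\mu)$ is a jointly measurable action of $G$ on $X$ preserving the probability measure $\mu$; it is ergodic if every measurable set $A\subseteq X$ with $\mu(g^{-1}A\,\triangle\,A)=0$ for all $g\in G$ has $\mu(A)\in\{0,1\}$. For a Polish group $L$, a measurable cocycle is a measurable map $\alpha:G\times X\to L$ such that for all $g,h\in G$ one has $\alpha(gh,x)=\alpha(g,h.x)\,\alpha(h,x)$ for $\mu$-a.e. $x$. Suppose that $G\curvearrowright(X,\mu)$ is an ergodic p.m.p. action that is $\mathscr{G}_{\rm cmp}$-cocycle superrigid, that is: for every second countable compact (Hausdorff) group $L$ and every measurable cocycle $\alpha:G\times X\to L$ there exist a measurable map $\phi:X\to L$ and a homomorphism $\varrho:G\to L$ such that, for each $g\in G$, $$\alpha(g,x)=\phi(g.x)\,\varrho(g)\,\phi(x)^{-1}\qquad\text{for }\mu\text{-a.e. }x\in X .$$ Let $p:(X',\mu')\to(X,\mu)$ be a p.m.p. extension: $G\curvearrowright(X',\mu')$ is a p.m.p. action, $p:X'\to X$ is measurable with $p_*\mu'=\mu$,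 and for each $g\in G$ one has $p(g.x')=g.p(x')$ for $\mu'$-a.e. $x'\in X'$. Assume that $G\curvearrowright(X',\mu')$ is weakly mixing, that is, the diagonal action of $G$ on $(X'\times X',\mu'\times\mu')$ is ergodic. Then $p$ is a relatively weakly mixing extension: if $\mu'=\int_X\mu'_x\,d\mu(x)$ is the disintegration of $\mu'$ along $p$, then the diagonal action of $G$ on the fibered product $X'\times_X X'=\{(x_1,x_2)\in X'\times X' : p(x_1)=p(x_2)\}$, equipped with the probability measure $\mu'\times_\mu\mu'=\int_X\mu'_x\times\mu'_x\,d\mu(x)$, preserves this measure and is ergodic. -/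

import Mathlib

open MeasureTheory ProbabilityTheory

/-- A measurable cocycle `α : G × X → L` over the action of `G` on `(X, μ)`: a jointly measurable
map with `α(gh, x) = α(g, h.x) α(h, x)` for all `g`, `h` and `μ`-almost every `x`. -/
structure IsMeasurableCocycle {G X L : Type*} [Group G] [MeasurableSpace G]
    [MeasurableSpace X] [MulAction G X] [Group L] [MeasurableSpace L]
    (μ : Measure X) (α : G → X → L) : Prop where
  measurable : Measurable (Function.uncurry α)
  map_mul : ∀ g h : G, ∀ᵐ x ∂μ, α (g * h) x = α g (h • x) * α h x

/-- The action of `G` on `(X, μ)` is `L`-cocycle-superrigid: it is ergodic and measure preserving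
(both are part of `ErgodicSMul`), and every measurable cocycle `α : G × X → L` is of the form
`α(g, x) = φ(g.x) ϱ(g) φ(x)⁻¹` with `φ : X → L` measurable and `ϱ : G → L` a homomorphism. -/
def IsCocycleSuperrigid (G : Type*) {X : Type*} (L : Type*) [Group G] [MeasurableSpace G]
    [MeasurableSpace X] [MulAction G X] [Group L] [MeasurableSpace L] (μ : Measure X) : Prop :=
  ErgodicSMul G X μ ∧
    ∀ α : G → X → L, IsMeasurableCocycle μ α →
      ∃ (φ : X → L) (ρ : G →* L), Measurable φ ∧
        ∀ g : G, ∀ᵐ x ∂μ, α g x = φ (g • x) * ρ g * (φ x)⁻¹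

/-- The action is `L`-cocycle-superrigid for every second countable compact (Hausdorff) group `L`,
with its Borel σ-algebra. Such a group has at most the cardinality of the continuum, so that
letting `L` range over `Type` covers all of them up to isomorphism. -/
def IsCompactCocycleSuperrigid (G : Type*) {X : Type*} [Group G] [MeasurableSpace G]
    [MeasurableSpace X] [MulAction G X] (μ : Measure X) : Prop :=
  ∀ (L : Type) [Group L] [TopologicalSpace L] [IsTopologicalGroup L] [CompactSpace L] [T2Space L]
    [SecondCountableTopology L] [MeasurableSpace L] [BorelSpace L], IsCocycleSuperrigid G L μ

/-- The action of `G` on `(X, μ)` is weakly mixing: the diagonal action on `(X × X, μ × μ)` is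
ergodic. -/
def IsWeaklyMixing (G : Type*) {X : Type*} [Group G] [MeasurableSpace X] [MulAction G X]
    (μ : Measure X) : Prop :=
  ErgodicSMul G (X × X) (μ.prod μ)

/-- `p : (X', μ') → (X, μ)` is a morphism of probability measure preserving `G`-actions, i.e.
`(X', μ')` is an extension of `(X, μ)`. -/
structure IsExtension (G : Type*) {X' X : Type*} [Group G] [MeasurableSpace X']
    [MeasurableSpace X] [MulAction G X'] [MulAction G X]
    (μ' : Measure X') (μ : Measure X) (p : X' → X) : Prop where
  measurePreserving : MeasurePreserving p μ' μ
  equivariant : ∀ g : G, ∀ᵐ x' ∂μ', p (g • x') = g • p x'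

/-- The disintegration `x ↦ μ'_x` of `μ'` along `p : X' → X`: the regular conditional distribution
of a `μ'`-random point `x'` given the value of `p x'`. -/
noncomputable def disintegration {X' X : Type*} [MeasurableSpace X'] [StandardBorelSpace X']
    [MeasurableSpace X] (μ' : Measure X') [IsProbabilityMeasure μ'] (p : X' → X) : Kernel X X' :=
  haveI : Nonempty X' := nonempty_of_isProbabilityMeasure μ'
  condDistrib id p μ'

/-- The fibered product measure `μ' ×_μ μ' = ∫ μ'_x × μ'_x dμ(x)`. It is regarded as a measure on
`X' × X'`, where it is concentrated on the fibered product `{(a, b) | p a = p b}`. -/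
noncomputable def fiberedProductMeasure {X' X : Type*} [MeasurableSpace X'] [StandardBorelSpace X']
    [MeasurableSpace X] (μ' : Measure X') [IsProbabilityMeasure μ'] (μ : Measure X)
    (p : X' → X) : Measure (X' × X') :=
  μ.bind fun x => (disintegration μ' p x).prod (disintegration μ' p x)

/-- The extension `p : (X', μ') → (X, μ)` is relatively weakly mixing: the diagonal action of `G`
on the fibered product `X' ×_X X'` with the measure `μ' ×_μ μ'` is ergodic. As `p` is equivariant
only almost everywhere, the set `X' ×_X X'` is only invariant modulo null sets, and the diagonal
action is taken on `X' × X'`. -/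
def IsRelativelyWeaklyMixing (G : Type*) {X' X : Type*} [Group G] [MeasurableSpace X']
    [StandardBorelSpace X'] [MeasurableSpace X] [MulAction G X']
    (μ' : Measure X') [IsProbabilityMeasure μ'] (μ : Measure X) (p : X' → X) : Prop :=
  ErgodicSMul G (X' × X') (fiberedProductMeasure μ' μ p)

/-! Disintegrate `μ'` into fibre measures `κ x` and regard the indicator of an invariant subset of
the fibered product as an integral kernel `a` on each fibre. The row integrals of `a` form an
invariant function on `X'`, which is ergodic because it is weakly mixing, so they equal a constant
`c`. It has to be shown that `K = a - c`, which annihilates constants, vanishes; equivalently, that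
the symmetric invariant kernel `T = KᵀK` vanishes.

If `T` is not zero, its powers `T ^ (2n)`, suitably normalised, converge to the projection `P` onto
the top eigenspace of `T ^ 2` on each fibre. No spectral theorem is needed: the row norms of all
powers of `T` are invariant functions, hence constants, and their log-convexity and
submultiplicativity determine the growth rate and make the convergence pointwise, with a single rate
for all fibres (`exists_invariant_projection`). The rows of `P` have constant squared norm `d > 0`,
so `P` has finite Hilbert–Schmidt norm and a finite measurable orthonormal frame
(`exists_orthonormal_frame`).

In this frame `G` acts through a cocycle with values in a compact orthogonal group. Superrigidity
lets the frame be rotated until `G` acts through constant matrices `ρ g`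
(`exists_equivariant_frame`). The rotated frame is an equivariant map from `X'` to a
finite-dimensional orthogonal representation, hence constant by weak mixing
(`IsWeaklyMixing.ae_const_of_orthogonal`). Then `P` is constant on fibres; as it annihilates
constants it is zero, contradicting `d > 0`. -/

/-! ### Bounded kernels and their composition. -/

section KernelCalculus

open Filter Topology Function

/-- A bounded measurable real function. -/
def IsBddMeas {Y : Type*} [MeasurableSpace Y] (u : Y → ℝ) : Prop :=
  Measurable u ∧ ∃ C, ∀ y, |u y| ≤ C

namespace IsBddMeas

variable {Y Z : Type*} [MeasurableSpace Y] [MeasurableSpace Z] {u v : Y → ℝ}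

theorem mul (hu : IsBddMeas u) (hv : IsBddMeas v) : IsBddMeas fun y => u y * v y := by
  obtain ⟨hu, C, hC⟩ := hu
  obtain ⟨hv, D, hD⟩ := hv
  refine ⟨hu.mul hv, C * D, fun y => ?_⟩
  rw [abs_mul]
  exact mul_le_mul (hC y) (hD y) (abs_nonneg _) ((abs_nonneg _).trans (hC y))

theorem sub (hu : IsBddMeas u) (hv : IsBddMeas v) : IsBddMeas fun y => u y - v y := by
  obtain ⟨hu, C, hC⟩ := hu
  obtain ⟨hv, D, hD⟩ := hv
  exact ⟨hu.sub hv, C + D, fun y => (abs_sub _ _).trans (add_le_add (hC y) (hD y))⟩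

theorem add (hu : IsBddMeas u) (hv : IsBddMeas v) : IsBddMeas fun y => u y + v y := by
  obtain ⟨hu, C, hC⟩ := hu
  obtain ⟨hv, D, hD⟩ := hv
  exact ⟨hu.add hv, C + D, fun y => (abs_add_le _ _).trans (add_le_add (hC y) (hD y))⟩

theorem const (c : ℝ) : IsBddMeas fun _ : Y => c :=
  ⟨measurable_const, |c|, fun _ => le_rfl⟩

theorem sum {ι : Type*} (s : Finset ι) {w : ι → Y → ℝ} (hw : ∀ i, IsBddMeas (w i)) :
    IsBddMeas fun y => ∑ i ∈ s, w i y := by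
  classical
  induction s using Finset.induction_on with
  | empty => simpa using const (Y := Y) 0
  | insert i s hi ih => simpa [Finset.sum_insert hi] using (hw i).add ih

theorem sq (hu : IsBddMeas u) : IsBddMeas fun y => u y ^ 2 := by
  simpa only [_root_.sq] using hu.mul hu

theorem comp (hu : IsBddMeas u) {f : Z → Y} (hf : Measurable f) : IsBddMeas fun z => u (f z) :=
  ⟨hu.1.comp hf, hu.2.imp fun _ h z => h (f z)⟩

theorem indicator {s : Set Y} (hs : MeasurableSet s) :
    IsBddMeas (s.indicator (fun _ => (1 : ℝ))) := by
  refine ⟨measurable_const.indicator hs, 1, fun y => ?_⟩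
  by_cases hy : y ∈ s <;> simp [hy]

theorem integrable (hu : IsBddMeas u) (m : Measure Y) [IsFiniteMeasure m] : Integrable u m := by
  obtain ⟨hu, C, hC⟩ := hu
  exact Integrable.of_bound hu.aestronglyMeasurable C
    (Eventually.of_forall fun y => by simpa using hC y)

theorem abs_integral_le {C : ℝ} (hC : ∀ y, |u y| ≤ C) (m : Measure Y) [IsProbabilityMeasure m] :
    |∫ y, u y ∂m| ≤ C := by
  simpa using norm_integral_le_of_norm_le_const (μ := m)
    (Eventually.of_forall fun y => show ‖u y‖ ≤ C by simpa using hC y)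

theorem integral_right {a : Y → Z → ℝ} (ha : IsBddMeas (uncurry a)) (m : Measure Z)
    [IsProbabilityMeasure m] : IsBddMeas fun y => ∫ z, a y z ∂m := by
  obtain ⟨ha, C, hC⟩ := ha
  exact ⟨(ha.stronglyMeasurable.integral_prod_right (ν := m)).measurable, C,
    fun y => abs_integral_le (fun z => hC (y, z)) m⟩

theorem row {a : Y → Z → ℝ} (ha : IsBddMeas (uncurry a)) (y : Y) : IsBddMeas (a y) :=
  ha.comp (f := fun z => (y, z)) measurable_prodMk_left

theorem swap {a : Y → Z → ℝ} (ha : IsBddMeas (uncurry a)) :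
    IsBddMeas (uncurry fun z y => a y z) :=
  ha.comp measurable_swap

theorem col {a : Y → Z → ℝ} (ha : IsBddMeas (uncurry a)) (z : Z) : IsBddMeas fun y => a y z :=
  ha.swap.row z

theorem ae_eq_zero_of_integral_sq (hu : IsBddMeas u) (m : Measure Y) [IsFiniteMeasure m]
    (h : ∫ y, u y ^ 2 ∂m = 0) : ∀ᵐ y ∂m, u y = 0 := by
  have := (integral_eq_zero_iff_of_nonneg (fun y => sq_nonneg (u y)) (hu.sq.integrable m)).1 h
  filter_upwards [this] with y hy
  simpa using hy

/-- The Cauchy–Schwarz inequality. -/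
theorem integral_mul_sq_le (hu : IsBddMeas u) (hv : IsBddMeas v) (m : Measure Y)
    [IsFiniteMeasure m] :
    (∫ y, u y * v y ∂m) ^ 2 ≤ (∫ y, u y ^ 2 ∂m) * ∫ y, v y ^ 2 ∂m := by
  -- The quadratic `s ↦ ∫ (s u + v)²` is nonnegative, so its discriminant is at most zero.
  have key : ∀ s : ℝ, 0 ≤ (∫ y, u y ^ 2 ∂m) * (s * s) + (2 * ∫ y, u y * v y ∂m) * s
      + ∫ y, v y ^ 2 ∂m := by
    intro s
    have h : ∫ y, (u y * s + v y) ^ 2 ∂m = (∫ y, u y ^ 2 ∂m) * (s * s)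
        + (2 * ∫ y, u y * v y ∂m) * s + ∫ y, v y ^ 2 ∂m := by
      have h1 := hu.sq.integrable m
      have h2 := (hu.mul hv).integrable m
      have h3 := hv.sq.integrable m
      rw [← integral_mul_const, ← integral_const_mul, ← integral_mul_const,
        ← integral_add (h1.mul_const _) ((h2.const_mul _).mul_const _)]
      refine Eq.trans ?_ (integral_add ((h1.mul_const _).add ((h2.const_mul _).mul_const _)) h3)
      exact integral_congr_ae (Eventually.of_forall fun y => by ring)
    rw [← h]
    exact integral_nonneg fun y => sq_nonneg _
  have := discrim_le_zero key
  rw [discrim] at this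
  nlinarith

end IsBddMeas

/-- There is a sequence of measurable sets such that, for every finite measure, a bounded measurable
function whose integrals over all of these sets vanish is zero almost everywhere. -/
theorem exists_seq_integral_separating (Y : Type*) [MeasurableSpace Y]
    [MeasurableSpace.CountablyGenerated Y] :
    ∃ e : ℕ → Set Y, (∀ n, MeasurableSet (e n)) ∧ ∀ (m : Measure Y) [IsFiniteMeasure m] (u : Y → ℝ),
      IsBddMeas u → (∀ n, ∫ y, u y * (e n).indicator (fun _ => (1 : ℝ)) y ∂m = 0) →
      ∀ᵐ y ∂m, u y = 0 := by
  -- Passing to the generated algebra keeps countability and gives a π-system containing the whole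
  -- space, as the Dynkin argument below needs.
  set A := generateSetAlgebra (MeasurableSpace.countableGeneratingSet Y) with hA
  have hAc : A.Countable := countable_generateSetAlgebra
    (MeasurableSpace.countable_countableGeneratingSet (α := Y))
  have hgen : MeasurableSpace.generateFrom A = ‹MeasurableSpace Y› := by
    rw [hA, generateFrom_generateSetAlgebra_eq,
      MeasurableSpace.generateFrom_countableGeneratingSet]
  have halg : IsSetAlgebra A := isSetAlgebra_generateSetAlgebra
  obtain ⟨e, he⟩ := hAc.exists_eq_range ⟨∅, halg.empty_mem⟩
  have hmeas : ∀ n, MeasurableSet (e n) := fun n => by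
    have : MeasurableSet[MeasurableSpace.generateFrom A] (e n) :=
      MeasurableSpace.measurableSet_generateFrom (he ▸ Set.mem_range_self n)
    rwa [hgen] at this
  refine ⟨e, hmeas, fun m _ u hu h => ?_⟩
  have hint := hu.integrable m
  have hA0 : ∀ s ∈ A, ∫ y in s, u y ∂m = 0 := by
    intro s hs
    rw [he] at hs
    obtain ⟨n, rfl⟩ := hs
    rw [← integral_indicator (hmeas n), ← h n]
    refine integral_congr_ae (Eventually.of_forall fun y => ?_)
    by_cases hy : y ∈ e n <;> simp [hy]
  have hpi : IsPiSystem A := fun s hs t ht _ => halg.inter_mem hs ht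
  have huniv : ∫ y, u y ∂m = 0 := by
    simpa using hA0 Set.univ halg.univ_mem
  have hall : ∀ s, MeasurableSet s → ∫ y in s, u y ∂m = 0 := by
    intro s hs
    induction s, hs using MeasurableSpace.induction_on_inter hgen.symm hpi with
    | empty => simp
    | basic s hs => exact hA0 s hs
    | compl s hs ih =>
      have := integral_add_compl hs hint
      rw [ih, huniv] at this
      simpa using this
    | iUnion f hd hf ih =>
      rw [integral_iUnion hf hd hint.integrableOn]
      simp [ih]
  exact hint.ae_eq_zero_of_forall_setIntegral_eq_zero fun s hs _ => hall s hs

section Composition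

variable {Ω : Type*} [MeasurableSpace Ω] (m : Measure Ω) {a b c : Ω → Ω → ℝ}

/-- Composition of integral kernels with respect to the measure `m`. -/
noncomputable def kcomp (a b : Ω → Ω → ℝ) : Ω → Ω → ℝ := fun y z => ∫ w, a y w * b w z ∂m

/-- The `(n + 1)`-st power of an integral kernel. -/
noncomputable def kpow (a : Ω → Ω → ℝ) : ℕ → Ω → Ω → ℝ
  | 0 => a
  | n + 1 => kcomp m a (kpow a n)

variable [IsProbabilityMeasure m]

theorem IsBddMeas.kcomp (ha : IsBddMeas (uncurry a)) (hb : IsBddMeas (uncurry b)) :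
    IsBddMeas (uncurry (kcomp m a b)) := by
  have h : IsBddMeas (uncurry fun (q : Ω × Ω) w => a q.1 w * b w q.2) :=
    (ha.comp (f := fun r : (Ω × Ω) × Ω => (r.1.1, r.2)) (by fun_prop)).mul
      (hb.comp (f := fun r : (Ω × Ω) × Ω => (r.2, r.1.2)) (by fun_prop))
  exact h.integral_right m

/-- Fubini for bounded kernels, valid at every point. Identities between powers may therefore be
evaluated on the diagonal, even when it is a null set. -/
theorem kcomp_assoc (ha : IsBddMeas (uncurry a)) (hb : IsBddMeas (uncurry b))
    (hc : IsBddMeas (uncurry c)) :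
    kcomp m (kcomp m a b) c = kcomp m a (kcomp m b c) := by
  funext y z
  simp only [kcomp, ← integral_mul_const, ← integral_const_mul]
  rw [integral_integral_swap]
  · simp only [mul_assoc]
  · have h : IsBddMeas (uncurry fun w v => a y v * b v w * c w z) :=
      (((ha.row y).comp measurable_snd).mul hb.swap).mul ((hc.col z).comp measurable_fst)
    exact h.integrable _

theorem IsBddMeas.kpow (ha : IsBddMeas (uncurry a)) :
    ∀ n, IsBddMeas (uncurry (kpow m a n))
  | 0 => ha
  | n + 1 => ha.kcomp m (IsBddMeas.kpow ha n)

/-- Index `n` stands for exponent `n + 1`, which accounts for the extra `1`. -/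
theorem kcomp_kpow (ha : IsBddMeas (uncurry a)) (i j : ℕ) :
    kcomp m (kpow m a i) (kpow m a j) = kpow m a (i + j + 1) := by
  induction i with
  | zero => simp [kpow]
  | succ i ih =>
    rw [kpow, kcomp_assoc m ha (ha.kpow m i) (ha.kpow m j), ih,
      show i + 1 + j + 1 = (i + j + 1) + 1 by ring, ← kpow]

theorem kpow_symm (ha : IsBddMeas (uncurry a)) (hs : ∀ y z, a y z = a z y) (n : ℕ) (y z : Ω) :
    kpow m a n y z = kpow m a n z y := by
  induction n generalizing y z with
  | zero => exact hs y z
  | succ n ih =>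
    have h := congrFun (congrFun (kcomp_kpow m ha n 0) z) y
    rw [add_zero] at h
    rw [← h]
    simp only [kpow, kcomp]
    congr 1
    funext w
    rw [ih w z, hs y w, mul_comm]

end Composition

end KernelCalculus

/-! ### Vanishing of `KᵀK` and growth of log-convex sequences. -/

section KernelSpectral

open Filter Topology Function

/-- If `KᵀK = 0` almost everywhere, then `K = 0` almost everywhere. -/
theorem ae_eq_zero_of_transpose_kcomp_self {Ω : Type*} [MeasurableSpace Ω]
    [MeasurableSpace.CountablyGenerated Ω] (m : Measure Ω) [IsProbabilityMeasure m]
    {K : Ω → Ω → ℝ} (hK : IsBddMeas (uncurry K))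
    (h : ∀ᵐ y ∂m, ∀ᵐ z ∂m, kcomp m (fun y z => K z y) K y z = 0) :
    ∀ᵐ y ∂m, ∀ᵐ z ∂m, K y z = 0 := by
  obtain ⟨e, hem, he⟩ := exists_seq_integral_separating Ω
  have key : ∀ n, ∀ᵐ w ∂m, ∫ y, K w y * (e n).indicator (fun _ => (1 : ℝ)) y ∂m = 0 := by
    intro n
    set E := (e n).indicator (fun _ => (1 : ℝ)) with hE
    have hEb : IsBddMeas E := .indicator (hem n)
    have hEr : IsBddMeas (uncurry fun _ y : Ω => E y) := hEb.comp measurable_snd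
    have hEc : IsBddMeas (uncurry fun y _ : Ω => E y) := hEb.comp measurable_fst
    have hKE : IsBddMeas (uncurry (kcomp m K fun y _ : Ω => E y)) := hK.kcomp m hEc
    obtain ⟨w₀⟩ : Nonempty Ω := nonempty_of_isProbabilityMeasure m
    refine (hKE.col w₀).ae_eq_zero_of_integral_sq m ?_
    have h1 : kcomp m (kcomp m (fun _ y : Ω => E y) fun y z => K z y)
        (kcomp m K fun y _ : Ω => E y) w₀ w₀ = 0 := by
      rw [kcomp_assoc m hEr hK.swap hKE, ← kcomp_assoc m hK.swap hK hEc]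
      refine integral_eq_zero_of_ae ?_
      filter_upwards [h] with y hy
      have : kcomp m (kcomp m (fun y z => K z y) K) (fun y _ : Ω => E y) y w₀ = 0 := by
        refine integral_eq_zero_of_ae ?_
        filter_upwards [hy] with z hz
        simp [hz]
      simp [this]
    rw [← h1]
    refine integral_congr_ae (Eventually.of_forall fun w => ?_)
    simp only [_root_.sq]
    congr 1
    exact integral_congr_ae (Eventually.of_forall fun y => mul_comm _ _)
  filter_upwards [ae_all_iff.2 key] with w hw
  exact he m (K w) (hK.row w) hw

/-- A log-convex submultiplicative positive sequence has exact exponential growth. -/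
theorem exists_tendsto_div_pow {U : ℕ → ℝ} (hpos : ∀ n, 0 < U n)
    (hconv : ∀ n, U (n + 1) ^ 2 ≤ U n * U (n + 2)) (hsub : ∀ i j, U (i + j + 1) ≤ U i * U j) :
    ∃ Λ d : ℝ, 0 < Λ ∧ 0 < d ∧ Tendsto (fun n => U n / Λ ^ (n + 1)) atTop (𝓝 d) := by
  set r : ℕ → ℝ := fun n => U (n + 1) / U n with hr
  have hrpos : ∀ n, 0 < r n := fun n => div_pos (hpos _) (hpos _)
  -- Log-convexity makes the ratios increase, and submultiplicativity bounds them by `U 0`; their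
  -- limit is the growth rate `Λ`.
  have hrmono : Monotone r := by
    refine monotone_nat_of_le_succ fun n => ?_
    rw [hr]
    simp only
    rw [div_le_div_iff₀ (hpos _) (hpos _)]
    nlinarith [hconv n]
  have hrbdd : BddAbove (Set.range r) := by
    refine ⟨U 0, ?_⟩
    rintro _ ⟨n, rfl⟩
    rw [hr]
    simp only
    rw [div_le_iff₀ (hpos _)]
    simpa [mul_comm] using hsub n 0
  set Λ := ⨆ n, r n with hΛ
  have hlim : Tendsto r atTop (𝓝 Λ) := tendsto_atTop_ciSup hrmono hrbdd
  have hle : ∀ n, r n ≤ Λ := fun n => le_ciSup hrbdd n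
  have hΛpos : 0 < Λ := (hrpos 0).trans_le (hle 0)
  set V : ℕ → ℝ := fun n => U n / Λ ^ (n + 1) with hV
  have hVpos : ∀ n, 0 < V n := fun n => div_pos (hpos _) (by positivity)
  have hVsucc : ∀ n, V (n + 1) = V n * (r n / Λ) := by
    intro n
    have := (hpos n).ne'
    simp only [hV, hr]
    field_simp
    ring
  have hVsub : ∀ i j, V (i + j + 1) ≤ V i * V j := by
    intro i j
    have := hsub i j
    simp only [hV]
    rw [div_mul_div_comm, ← pow_add, show i + j + 1 + 1 = i + 1 + (j + 1) by ring]
    gcongr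
  have hanti : Antitone V := by
    refine antitone_nat_of_succ_le fun n => ?_
    rw [hVsucc]
    exact mul_le_of_le_one_right (hVpos n).le ((div_le_one hΛpos).2 (hle n))
  -- This makes the limit positive. A value below `1` would force geometric decay of `V`, which is
  -- impossible when consecutive ratios tend to `1`.
  have hge : ∀ n, 1 ≤ V n := by
    intro a
    by_contra! hlt
    -- powers of `V a` dominate a subsequence of `V`
    have hpow : ∀ k, V (k * (a + 1) + a) ≤ V a ^ (k + 1) := by
      intro k
      induction k with
      | zero => simp
      | succ k ih =>
        have h1 := hVsub (k * (a + 1) + a) a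
        have h2 : (k + 1) * (a + 1) + a = k * (a + 1) + a + a + 1 := by ring
        rw [h2]
        refine h1.trans ?_
        rw [pow_succ]
        exact mul_le_mul_of_nonneg_right ih (hVpos a).le
    -- but the ratios of consecutive terms tend to `1`
    obtain ⟨q, hq0, hq1, hqa⟩ : ∃ q : ℝ, 0 < q ∧ q < 1 ∧ V a < q ^ (a + 1) := by
      have hc : Tendsto (fun q : ℝ => q ^ (a + 1)) (𝓝[<] 1) (𝓝 1) := by
        have : ContinuousAt (fun q : ℝ => q ^ (a + 1)) 1 := by fun_prop
        simpa using (this.tendsto.mono_left nhdsWithin_le_nhds)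
      have h1 := hc.eventually (lt_mem_nhds hlt)
      have h2 : ∀ᶠ q : ℝ in 𝓝[<] 1, 0 < q :=
        nhdsWithin_le_nhds (lt_mem_nhds one_pos)
      have h3 : ∀ᶠ q : ℝ in 𝓝[<] 1, q < 1 := self_mem_nhdsWithin
      obtain ⟨q, h⟩ := (h1.and (h2.and h3)).exists
      exact ⟨q, h.2.1, h.2.2, h.1⟩
    have hev : ∀ᶠ n in atTop, q ≤ r n / Λ := by
      have : Tendsto (fun n => r n / Λ) atTop (𝓝 1) := by
        simpa [div_self hΛpos.ne'] using hlim.div_const Λ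
      exact (this.eventually (lt_mem_nhds hq1)).mono fun n h => h.le
    obtain ⟨N, hN⟩ := eventually_atTop.1 hev
    have hlow : ∀ k, V N * q ^ k ≤ V (N + k) := by
      intro k
      induction k with
      | zero => simp
      | succ k ih =>
        rw [← add_assoc, hVsucc, pow_succ, ← mul_assoc]
        exact mul_le_mul ih (hN _ (by omega)) hq0.le (hVpos _).le
    have hlow' : ∀ k, V N * q ^ k ≤ V k := fun k =>
      (hlow k).trans (hanti (by omega))
    have hs : Tendsto (fun k => (V a / q ^ (a + 1)) ^ (k + 1)) atTop (𝓝 0) :=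
      (tendsto_pow_atTop_nhds_zero_of_lt_one (by have := hVpos a; positivity)
        ((div_lt_one (by positivity)).2 hqa)).comp (tendsto_add_atTop_nat 1)
    have hge : ∀ k, V N ≤ (V a / q ^ (a + 1)) ^ (k + 1) := by
      intro k
      have h1 := (hlow' (k * (a + 1) + a)).trans (hpow k)
      rw [div_pow, le_div_iff₀ (by positivity), ← pow_mul]
      refine le_trans (mul_le_mul_of_nonneg_left ?_ (hVpos N).le) h1
      exact pow_le_pow_of_le_one hq0.le hq1.le (by nlinarith)
    exact absurd (ge_of_tendsto' hs hge) (not_le.2 (hVpos N))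
  have hbelow : BddBelow (Set.range V) := ⟨1, by rintro _ ⟨n, rfl⟩; exact hge n⟩
  refine ⟨Λ, ⨅ n, V n, hΛpos, zero_lt_one.trans_le (le_ciInf hge), ?_⟩
  exact tendsto_atTop_ciInf hanti hbelow

end KernelSpectral

/-! ### Convergence of normalised even powers to a projection. -/

section SpectralLimit

open Filter Topology Function

variable {Ω : Type*} [MeasurableSpace Ω]

/-- The even powers `T ^ (2 (n + 1)) / Λ ^ (n + 1)` of a kernel. -/
noncomputable def spectralSeq (m : Measure Ω) (T : Ω → Ω → ℝ) (Λ : ℝ) (n : ℕ) : Ω → Ω → ℝ :=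
  fun y z => kpow m T (2 * n + 1) y z / Λ ^ (n + 1)

/-- The limit of `spectralSeq`, truncated at `B`: the projection onto the top eigenspace. -/
noncomputable def spectralLim (m : Measure Ω) (T : Ω → Ω → ℝ) (Λ B : ℝ) : Ω → Ω → ℝ :=
  fun y z => limsup (fun n => max (-B) (min B (spectralSeq m T Λ n y z))) atTop

variable (m : Measure Ω) [IsProbabilityMeasure m] {T : Ω → Ω → ℝ} {Λ B d : ℝ} {U : ℕ → ℝ}

theorem IsBddMeas.spectralSeq (hT : IsBddMeas (uncurry T)) (n : ℕ) :
    IsBddMeas (uncurry (spectralSeq m T Λ n)) := by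
  have h := (hT.kpow m (2 * n + 1)).mul (.const (Λ ^ (n + 1))⁻¹)
  simp only [← div_eq_mul_inv] at h
  exact h

theorem kcomp_spectralSeq (hT : IsBddMeas (uncurry T)) (i j : ℕ) :
    kcomp m (spectralSeq m T Λ i) (spectralSeq m T Λ j) = spectralSeq m T Λ (i + j + 1) := by
  funext y z
  have h := congrFun (congrFun (kcomp_kpow m hT (2 * i + 1) (2 * j + 1)) y) z
  simp only [spectralSeq]
  rw [show 2 * (i + j + 1) + 1 = 2 * i + 1 + (2 * j + 1) + 1 by ring, ← h, kcomp, kcomp,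
    ← integral_div]
  refine integral_congr_ae (Eventually.of_forall fun w => ?_)
  simp only [spectralSeq]
  rw [div_mul_div_comm, ← pow_add, show i + 1 + (j + 1) = i + j + 1 + 1 by ring]

theorem spectralSeq_symm (hT : IsBddMeas (uncurry T)) (hs : ∀ y z, T y z = T z y) (n : ℕ)
    (y z : Ω) : spectralSeq m T Λ n y z = spectralSeq m T Λ n z y := by
  simp only [spectralSeq, kpow_symm m hT hs _ y z]

omit [IsProbabilityMeasure m] in
theorem abs_clip_le {B : ℝ} (hB : 0 ≤ B) (s : ℝ) : |max (-B) (min B s)| ≤ B := by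
  rw [abs_le]
  exact ⟨le_max_left _ _, max_le (by linarith) (min_le_left _ _)⟩

-- Truncation keeps the limsup bounded at every point, including those where the powers fail to
-- converge.
omit [IsProbabilityMeasure m] in
theorem abs_limsup_clip_le {B : ℝ} (hB : 0 ≤ B) (s : ℕ → ℝ) :
    |limsup (fun n => max (-B) (min B (s n))) atTop| ≤ B := by
  have h : ∀ n, -B ≤ max (-B) (min B (s n)) ∧ max (-B) (min B (s n)) ≤ B := fun n =>
    abs_le.1 (abs_clip_le hB (s n))
  have hbu : IsBoundedUnder (· ≤ ·) atTop fun n => max (-B) (min B (s n)) :=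
    isBoundedUnder_of ⟨B, fun n => (h n).2⟩
  have hbl : IsBoundedUnder (· ≥ ·) atTop fun n => max (-B) (min B (s n)) :=
    isBoundedUnder_of ⟨-B, fun n => (h n).1⟩
  rw [abs_le]
  exact ⟨le_limsup_of_frequently_le (Frequently.of_forall fun n => (h n).1) hbu,
    limsup_le_of_le hbl.isCoboundedUnder_le (Eventually.of_forall fun n => (h n).2)⟩

theorem IsBddMeas.spectralLim (hT : IsBddMeas (uncurry T)) (hB : 0 ≤ B) :
    IsBddMeas (uncurry (spectralLim m T Λ B)) := by
  refine ⟨?_, B, fun q => abs_limsup_clip_le hB _⟩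
  exact Measurable.limsup fun n =>
    measurable_const.max (measurable_const.min (hT.spectralSeq m n).1)

theorem spectralLim_symm (hT : IsBddMeas (uncurry T)) (hs : ∀ y z, T y z = T z y) (y z : Ω) :
    spectralLim m T Λ B y z = spectralLim m T Λ B z y := by
  simp only [spectralLim, spectralSeq_symm m hT hs _ y z]

section Estimates

variable (hT : IsBddMeas (uncurry T)) (hs : ∀ y z, T y z = T z y)
include hT hs

/-- By symmetry, the diagonal value of `T ^ (2n + 2)` is the squared norm of a row of `T ^ (n + 1)`.
-/
theorem spectralSeq_diag {y : Ω} {n : ℕ} (hy : ∫ z, kpow m T n y z ^ 2 ∂m = U n) :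
    spectralSeq m T Λ n y y = U n / Λ ^ (n + 1) := by
  rw [spectralSeq, show 2 * n + 1 = n + n + 1 by ring, ← kcomp_kpow m hT, ← hy, kcomp]
  congr 1
  refine integral_congr_ae (Eventually.of_forall fun w => ?_)
  simp only [kpow_symm m hT hs n w y, _root_.sq]

/-- The inner product is a diagonal value of the composed kernel, so it depends only on `i + j` and
not on the point. -/
theorem integral_spectralSeq_mul {y : Ω} (hy : ∀ n, ∫ z, kpow m T n y z ^ 2 ∂m = U n) (i j : ℕ) :
    ∫ z, spectralSeq m T Λ i y z * spectralSeq m T Λ j y z ∂m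
      = U (i + j + 1) / Λ ^ (i + j + 1 + 1) := by
  rw [← spectralSeq_diag m hT hs (hy (i + j + 1)), ← kcomp_spectralSeq m hT, kcomp]
  refine integral_congr_ae (Eventually.of_forall fun w => ?_)
  simp only [spectralSeq_symm m hT hs j w y]

/-- Since the term of index `i + 1` is the composition of those of index `0` and `i`, Cauchy–Schwarz
turns convergence of rows in `L²` into pointwise convergence. -/
theorem spectralSeq_sub_sq_le {y z : Ω} (hy : ∀ n, ∫ z, kpow m T n y z ^ 2 ∂m = U n)
    (hz : ∀ n, ∫ w, kpow m T n z w ^ 2 ∂m = U n) (i j : ℕ) :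
    (spectralSeq m T Λ (i + 1) y z - spectralSeq m T Λ (j + 1) y z) ^ 2
      ≤ U 1 / Λ ^ (1 + 1) * (U (i + i + 1) / Λ ^ (i + i + 1 + 1)
        + U (j + j + 1) / Λ ^ (j + j + 1 + 1) - 2 * (U (i + j + 1) / Λ ^ (i + j + 1 + 1))) := by
  have hS := fun n => hT.spectralSeq m (Λ := Λ) n
  have e : spectralSeq m T Λ (i + 1) y z - spectralSeq m T Λ (j + 1) y z
      = ∫ w, spectralSeq m T Λ 0 y w * (spectralSeq m T Λ i z w - spectralSeq m T Λ j z w) ∂m := by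
    have h : ∀ n, spectralSeq m T Λ (n + 1) y z
        = ∫ w, spectralSeq m T Λ 0 y w * spectralSeq m T Λ n z w ∂m := fun n => by
      rw [← zero_add n, ← kcomp_spectralSeq m hT, kcomp, zero_add]
      refine integral_congr_ae (Eventually.of_forall fun w => ?_)
      simp only [spectralSeq_symm m hT hs n w z]
    rw [h i, h j, ← integral_sub ((((hS 0).row y).mul ((hS i).row z)).integrable m)
      ((((hS 0).row y).mul ((hS j).row z)).integrable m)]
    simp only [mul_sub]
  rw [e]
  refine (((hS 0).row y).integral_mul_sq_le (((hS i).row z).sub ((hS j).row z)) m).trans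
    (le_of_eq ?_)
  congr 1
  · rw [← integral_spectralSeq_mul m hT hs hy 0 0]
    simp only [_root_.sq]
  · have i1 := (((hS i).row z).mul ((hS i).row z)).integrable m
    have i2 := (((hS j).row z).mul ((hS j).row z)).integrable m
    have i3 := (((hS i).row z).mul ((hS j).row z)).integrable m
    rw [← integral_spectralSeq_mul m hT hs hz i i, ← integral_spectralSeq_mul m hT hs hz j j,
      ← integral_spectralSeq_mul m hT hs hz i j, ← integral_const_mul, ← integral_add i1 i2]
    refine Eq.trans ?_ (integral_sub (i1.add i2) (i3.const_mul 2))
    exact integral_congr_ae (Eventually.of_forall fun w => by ring)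

theorem spectralSeq_succ_sq_le {y z : Ω} (hy : ∀ n, ∫ z, kpow m T n y z ^ 2 ∂m = U n)
    (hz : ∀ n, ∫ w, kpow m T n z w ^ 2 ∂m = U n) (i : ℕ) :
    spectralSeq m T Λ (i + 1) y z ^ 2
      ≤ U 1 / Λ ^ (1 + 1) * (U (i + i + 1) / Λ ^ (i + i + 1 + 1)) := by
  have hS := fun n => hT.spectralSeq m (Λ := Λ) n
  rw [← integral_spectralSeq_mul m hT hs hy 0 0, ← integral_spectralSeq_mul m hT hs hz i i]
  rw [← zero_add i, ← kcomp_spectralSeq m hT, kcomp, zero_add]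
  simp only [spectralSeq_symm m hT hs i _ z, ← _root_.sq]
  exact ((hS 0).row y).integral_mul_sq_le ((hS i).row z) m

variable (hV : Tendsto (fun n => U n / Λ ^ (n + 1)) atTop (𝓝 d)) (hB : 0 ≤ B)
  (hUB : ∀ n, U 1 / Λ ^ (1 + 1) * (U n / Λ ^ (n + 1)) ≤ B ^ 2)
include hV hB hUB

theorem tendsto_spectralSeq {y z : Ω} (hy : ∀ n, ∫ z, kpow m T n y z ^ 2 ∂m = U n)
    (hz : ∀ n, ∫ w, kpow m T n z w ^ 2 ∂m = U n) :
    Tendsto (fun n => spectralSeq m T Λ n y z) atTop (𝓝 (spectralLim m T Λ B y z)) := by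
  set V : ℕ → ℝ := fun n => U n / Λ ^ (n + 1) with hVdef
  have hV1 : 0 ≤ V 1 := by
    simp only [hVdef]
    rw [← integral_spectralSeq_mul m hT hs hy 0 0]
    exact integral_nonneg fun w => mul_self_nonneg _
  have hcauchy : CauchySeq fun n => spectralSeq m T Λ (n + 1) y z := by
    refine Metric.cauchySeq_iff.2 fun ε hε => ?_
    -- Three values within `δ` of `d` make the bracket in the Cauchy estimate at most `4δ`; the `+
    -- 1` covers `V 1 = 0`.
    set δ := ε ^ 2 / (4 * (V 1 + 1)) with hδ
    have hδpos : 0 < δ := by positivity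
    obtain ⟨N, hN⟩ := Metric.tendsto_atTop.1 hV δ hδpos
    refine ⟨N, fun i hi j hj => ?_⟩
    have h := spectralSeq_sub_sq_le m hT hs (Λ := Λ) hy hz i j
    have h1 := abs_lt.1 (hN (i + i + 1) (by omega))
    have h2 := abs_lt.1 (hN (j + j + 1) (by omega))
    have h3 := abs_lt.1 (hN (i + j + 1) (by omega))
    rw [Real.dist_eq]
    refine abs_lt_of_sq_lt_sq (h.trans_lt ?_) hε.le
    have h4 : V (i + i + 1) + V (j + j + 1) - 2 * V (i + j + 1) ≤ 4 * δ := by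
      simp only [hVdef] at *
      linarith [h1.2, h2.2, h3.1]
    have h5 : V 1 * (4 * δ) < ε ^ 2 := by
      rw [hδ, show 4 * (ε ^ 2 / (4 * (V 1 + 1))) = ε ^ 2 / (V 1 + 1) by field_simp, ← mul_div_assoc,
        div_lt_iff₀ (by linarith)]
      nlinarith [pow_pos hε 2]
    exact (mul_le_mul_of_nonneg_left h4 hV1).trans_lt h5
  obtain ⟨l, hl⟩ := cauchySeq_tendsto_of_complete hcauchy
  have hlB : |l| ≤ B := by
    refine le_of_tendsto' hl.abs fun n => abs_le_of_sq_le_sq ?_ hB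
    exact (spectralSeq_succ_sq_le m hT hs hy hz n).trans (hUB _)
  have hl' : Tendsto (fun n => spectralSeq m T Λ n y z) atTop (𝓝 l) :=
    (tendsto_add_atTop_iff_nat 1).1 hl
  -- The limit lies in `[-B, B]`, so truncation does not change it.
  have hclip : Tendsto (fun n => max (-B) (min B (spectralSeq m T Λ n y z))) atTop (𝓝 l) := by
    have := (tendsto_const_nhds (x := -B)).max ((tendsto_const_nhds (x := B)).min hl')
    rwa [min_eq_right (abs_le.1 hlB).2, max_eq_right (abs_le.1 hlB).1] at this
  rw [spectralLim, hclip.limsup_eq]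
  exact hl'

variable (hU : ∀ᵐ y ∂m, ∀ n, ∫ z, kpow m T n y z ^ 2 ∂m = U n)
include hU

/-- Dominated convergence in the composition law. The shift to `n + 1` is needed because the uniform
bound `B` starts at index `1`. -/
theorem kcomp_spectralLim : ∀ᵐ y ∂m, ∀ᵐ z ∂m,
    kcomp m (spectralLim m T Λ B) (spectralLim m T Λ B) y z = spectralLim m T Λ B y z := by
  have hS := fun n => hT.spectralSeq m (Λ := Λ) n
  filter_upwards [hU] with y hy
  filter_upwards [hU] with z hz
  have h1 : Tendsto (fun n => spectralSeq m T Λ (n + 1 + (n + 1) + 1) y z) atTop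
      (𝓝 (spectralLim m T Λ B y z)) :=
    (tendsto_spectralSeq m hT hs hV hB hUB hy hz).comp
      (tendsto_atTop_mono (fun n => by simp only [id_eq]; omega) tendsto_id)
  refine tendsto_nhds_unique ?_ h1
  simp only [← kcomp_spectralSeq m hT, kcomp]
  refine tendsto_integral_of_dominated_convergence (fun _ => B * B)
    (fun n => (((hS _).row y).mul ((hS _).col z)).1.aestronglyMeasurable)
    (integrable_const _) (fun n => ?_) ?_
  · filter_upwards [hU] with w hw
    rw [Real.norm_eq_abs, abs_mul]
    exact mul_le_mul
      (abs_le_of_sq_le_sq ((spectralSeq_succ_sq_le m hT hs hy hw n).trans (hUB _)) hB)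
      (abs_le_of_sq_le_sq ((spectralSeq_succ_sq_le m hT hs hw hz n).trans (hUB _)) hB)
      (abs_nonneg _) hB
  · filter_upwards [hU] with w hw
    exact (((tendsto_spectralSeq m hT hs hV hB hUB hy hw).comp (tendsto_add_atTop_nat 1)).mul
      ((tendsto_spectralSeq m hT hs hV hB hUB hw hz).comp (tendsto_add_atTop_nat 1)))

theorem integral_spectralLim_sq :
    ∀ᵐ y ∂m, ∫ z, spectralLim m T Λ B y z ^ 2 ∂m = d := by
  have hS := fun n => hT.spectralSeq m (Λ := Λ) n
  filter_upwards [hU] with y hy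
  have h1 : Tendsto (fun n => U (n + 1 + (n + 1) + 1) / Λ ^ (n + 1 + (n + 1) + 1 + 1)) atTop
      (𝓝 d) :=
    hV.comp (tendsto_atTop_mono (fun n => by simp only [id_eq]; omega) tendsto_id)
  refine tendsto_nhds_unique ?_ h1
  simp only [← integral_spectralSeq_mul m hT hs (Λ := Λ) hy, _root_.sq]
  refine tendsto_integral_of_dominated_convergence (fun _ => B * B)
    (fun n => (((hS _).row y).mul ((hS _).row y)).1.aestronglyMeasurable)
    (integrable_const _) (fun n => ?_) ?_
  · filter_upwards [hU] with w hw
    rw [Real.norm_eq_abs, abs_mul]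
    exact mul_le_mul
      (abs_le_of_sq_le_sq ((spectralSeq_succ_sq_le m hT hs hy hw n).trans (hUB _)) hB)
      (abs_le_of_sq_le_sq ((spectralSeq_succ_sq_le m hT hs hy hw n).trans (hUB _)) hB)
      (abs_nonneg _) hB
  · filter_upwards [hU] with w hw
    exact (((tendsto_spectralSeq m hT hs hV hB hUB hy hw).comp (tendsto_add_atTop_nat 1)).mul
      ((tendsto_spectralSeq m hT hs hV hB hUB hy hw).comp (tendsto_add_atTop_nat 1)))

theorem integral_spectralLim (h0 : ∀ᵐ y ∂m, ∫ z, T y z ∂m = 0) :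
    ∀ᵐ y ∂m, ∫ z, spectralLim m T Λ B y z ∂m = 0 := by
  have hS := fun n => hT.spectralSeq m (Λ := Λ) n
  -- Higher powers kill the constants at every point: `T ^ (n + 2) 1 = T ^ (n + 1) (T 1)`, and the
  -- inner factor vanishes almost everywhere.
  have hpow : ∀ n y, ∫ z, kpow m T (n + 1) y z ∂m = 0 := by
    intro n y
    have h1 : IsBddMeas (uncurry fun _ _ : Ω => (1 : ℝ)) := .const 1
    have h2 := congrFun (congrFun (kcomp_assoc m (hT.kpow m n) hT h1) y) y
    have h3 := kcomp_kpow m hT n 0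
    simp only [kpow] at h3
    rw [h3] at h2
    simp only [kcomp, mul_one] at h2
    change ∫ z, kpow m T (n + 1) y z ∂m = _ at h2
    rw [h2]
    refine integral_eq_zero_of_ae ?_
    filter_upwards [h0] with w hw
    simp [hw]
  filter_upwards [hU] with y hy
  have h1 : Tendsto (fun n => ∫ z, spectralSeq m T Λ (n + 1) y z ∂m) atTop
      (𝓝 (∫ z, spectralLim m T Λ B y z ∂m)) := by
    refine tendsto_integral_of_dominated_convergence (fun _ => B)
      (fun n => ((hS _).row y).1.aestronglyMeasurable)
      (integrable_const _) (fun n => ?_) ?_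
    · filter_upwards [hU] with w hw
      exact abs_le_of_sq_le_sq ((spectralSeq_succ_sq_le m hT hs hy hw n).trans (hUB _)) hB
    · filter_upwards [hU] with w hw
      exact (tendsto_spectralSeq m hT hs hV hB hUB hy hw).comp (tendsto_add_atTop_nat 1)
  refine tendsto_nhds_unique h1 ?_
  simp only [spectralSeq, integral_div, hpow, zero_div, tendsto_const_nhds]

end Estimates

end SpectralLimit

/-! ### Invariant kernels over an ergodic fibration. -/

section InvariantKernels

open Filter Topology Function

section Transport

variable {Ω : Type*} [MeasurableSpace Ω] {m : Measure Ω} [IsProbabilityMeasure m] {φ : Ω → Ω}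
  {a a' b b' : Ω → Ω → ℝ}

theorem ae_ae_swap_of_measurable {m' : Measure Ω} [IsProbabilityMeasure m'] {u v : Ω → Ω → ℝ}
    (hu : Measurable (uncurry u)) (hv : Measurable (uncurry v))
    (h : ∀ᵐ y ∂m, ∀ᵐ z ∂m', u y z = v y z) : ∀ᵐ z ∂m', ∀ᵐ y ∂m, u y z = v y z :=
  (Measure.ae_ae_comm (p := fun y z => u y z = v y z) (measurableSet_eq_fun hu hv)).1 h

/-- Change of variables along `φ`. With `φ` the action of `g`, it shows that fibrewise composition
preserves invariance of kernels. -/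
theorem kcomp_map (hφ : Measurable φ) (ha' : IsBddMeas (uncurry a'))
    (hb : IsBddMeas (uncurry b)) (hb' : IsBddMeas (uncurry b'))
    (haa : ∀ᵐ y ∂m, ∀ᵐ z ∂m, a' (φ y) (φ z) = a y z)
    (hbb : ∀ᵐ y ∂m, ∀ᵐ z ∂m, b' (φ y) (φ z) = b y z) :
    ∀ᵐ y ∂m, ∀ᵐ z ∂m, kcomp (m.map φ) a' b' (φ y) (φ z) = kcomp m a b y z := by
  have hbb' : ∀ᵐ z ∂m, ∀ᵐ y ∂m, b' (φ y) (φ z) = b y z :=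
    ae_ae_swap_of_measurable (u := fun y z => b' (φ y) (φ z))
      (hb'.1.comp ((hφ.comp measurable_fst).prodMk (hφ.comp measurable_snd))) hb.1 hbb
  filter_upwards [haa] with y hy
  filter_upwards [hbb'] with z hz
  rw [kcomp, integral_map hφ.aemeasurable ((ha'.row _).mul (hb'.col _)).1.aestronglyMeasurable]
  refine integral_congr_ae ?_
  filter_upwards [hy, hz] with w h1 h2
  simp only [h1, h2]

theorem kpow_map (hφ : Measurable φ) (ha : IsBddMeas (uncurry a)) (ha' : IsBddMeas (uncurry a'))
    (haa : ∀ᵐ y ∂m, ∀ᵐ z ∂m, a' (φ y) (φ z) = a y z) (n : ℕ) :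
    ∀ᵐ y ∂m, ∀ᵐ z ∂m, kpow (m.map φ) a' n (φ y) (φ z) = kpow m a n y z := by
  have : IsProbabilityMeasure (m.map φ) := Measure.isProbabilityMeasure_map hφ.aemeasurable
  induction n with
  | zero => exact haa
  | succ n ih => exact kcomp_map hφ ha' (ha.kpow m n) (ha'.kpow _ n) haa ih

theorem spectralLim_map (hφ : Measurable φ) (ha : IsBddMeas (uncurry a))
    (ha' : IsBddMeas (uncurry a')) (haa : ∀ᵐ y ∂m, ∀ᵐ z ∂m, a' (φ y) (φ z) = a y z) (Λ B : ℝ) :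
    ∀ᵐ y ∂m, ∀ᵐ z ∂m, spectralLim (m.map φ) a' Λ B (φ y) (φ z) = spectralLim m a Λ B y z := by
  filter_upwards [ae_all_iff.2 fun n => kpow_map hφ ha ha' haa n] with y hy
  filter_upwards [ae_all_iff.2 hy] with z hz
  simp only [spectralLim, spectralSeq, hz]

omit [IsProbabilityMeasure m] in
theorem integral_sq_map (hφ : Measurable φ) (ha' : IsBddMeas (uncurry a'))
    (haa : ∀ᵐ y ∂m, ∀ᵐ z ∂m, a' (φ y) (φ z) = a y z) :
    ∀ᵐ y ∂m, ∫ z, a' (φ y) z ^ 2 ∂(m.map φ) = ∫ z, a y z ^ 2 ∂m := by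
  filter_upwards [haa] with y hy
  rw [integral_map hφ.aemeasurable (ha'.row _).sq.1.aestronglyMeasurable]
  refine integral_congr_ae ?_
  filter_upwards [hy] with z hz
  simp only [hz]

end Transport

section RowNorms

variable {Ω : Type*} [MeasurableSpace Ω] {m : Measure Ω} [IsProbabilityMeasure m]
  {T : Ω → Ω → ℝ} {U : ℕ → ℝ} (hT : IsBddMeas (uncurry T)) (hs : ∀ y z, T y z = T z y)
include hT hs

theorem kpow_add_apply (i j : ℕ) (y z : Ω) :
    kpow m T (i + j + 1) y z = ∫ w, kpow m T i y w * kpow m T j z w ∂m := by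
  rw [← kcomp_kpow m hT, kcomp]
  simp only [kpow_symm m hT hs j _ z]

/-- Moving one factor of `T` across the inner product makes `U (n + 1)` the product of rows of `T ^
(n + 1)` and `T ^ (n + 3)`; then apply Cauchy–Schwarz. -/
theorem rowNorm_log_convex {y : Ω} (hy : ∀ n, ∫ z, kpow m T n y z ^ 2 ∂m = U n) (n : ℕ) :
    U (n + 1) ^ 2 ≤ U n * U (n + 2) := by
  have h1 : U (n + 1) = ∫ z, kpow m T n y z * kpow m T (n + 2) y z ∂m := by
    rw [← kpow_add_apply hT hs, show n + (n + 2) + 1 = n + 1 + (n + 1) + 1 by ring,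
      kpow_add_apply hT hs, ← hy]
    simp only [_root_.sq]
  rw [h1, ← hy n, ← hy (n + 2)]
  exact ((hT.kpow m n).row y).integral_mul_sq_le ((hT.kpow m (n + 2)).row y) m

/-- Constancy of the row norms enters here: Cauchy–Schwarz bounds almost every entry of the row by
`U i * U j`, and the measure has mass one. -/
theorem rowNorm_submultiplicative {y : Ω} (hy : ∀ n, ∫ z, kpow m T n y z ^ 2 ∂m = U n)
    (hU : ∀ᵐ y ∂m, ∀ n, ∫ z, kpow m T n y z ^ 2 ∂m = U n) (i j : ℕ) :
    U (i + j + 1) ≤ U i * U j := by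
  rw [← hy (i + j + 1)]
  calc ∫ z, kpow m T (i + j + 1) y z ^ 2 ∂m ≤ ∫ _, U i * U j ∂m := by
        refine integral_mono_ae (((hT.kpow m _).row y).sq.integrable m) (integrable_const _) ?_
        filter_upwards [hU] with z hz
        rw [kpow_add_apply hT hs, ← hy i, ← hz j]
        exact ((hT.kpow m i).row y).integral_mul_sq_le ((hT.kpow m j).row z) m
    _ = U i * U j := by simp

/-- Index `1` is the square `T ^ 2`, which is `TᵀT` by symmetry. -/
theorem ae_eq_zero_of_rowNorm_one_eq_zero [MeasurableSpace.CountablyGenerated Ω]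
    (hU : ∀ᵐ y ∂m, ∫ z, kpow m T 1 y z ^ 2 ∂m = 0) : ∀ᵐ y ∂m, ∀ᵐ z ∂m, T y z = 0 := by
  refine ae_eq_zero_of_transpose_kcomp_self m hT ?_
  filter_upwards [hU] with y hy
  filter_upwards [((hT.kpow m 1).row y).ae_eq_zero_of_integral_sq m hy] with z hz
  rw [← hz]
  simp only [kpow, kcomp, hs _ y]

end RowNorms

variable {G X Ω : Type*} [MeasurableSpace X] [MeasurableSpace Ω]

/-- A family of fibre measures `κ x` over a base `(X, μ)`, equivariant under an action of `G` whose
invariant functions on the total space are constant almost everywhere. -/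
structure ErgodicFibration (G : Type*) [SMul G X] [SMul G Ω] (μ : Measure X) (κ : Kernel X Ω) :
    Prop where
  map_smul : ∀ g : G, ∀ᵐ x ∂μ, κ (g • x) = (κ x).map (g • ·)
  ae_const : ∀ r : X → Ω → ℝ, Measurable (uncurry r) →
    (∀ g : G, ∀ᵐ x ∂μ, ∀ᵐ y ∂κ x, r (g • x) (g • y) = r x y) →
    ∃ c, ∀ᵐ x ∂μ, ∀ᵐ y ∂κ x, r x y = c

/-- A family of kernels on the fibres which is invariant under `G` almost everywhere. -/
def IsInvariantKernel (G : Type*) [SMul G X] [SMul G Ω] (μ : Measure X) (κ : Kernel X Ω)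
    (a : X → Ω → Ω → ℝ) : Prop :=
  ∀ g : G, ∀ᵐ x ∂μ, ∀ᵐ y ∂κ x, ∀ᵐ z ∂κ x, a (g • x) (g • y) (g • z) = a x y z

variable {μ : Measure X} {κ : Kernel X Ω} [IsMarkovKernel κ]

theorem measurable_integral_fiber {Y : Type*} [MeasurableSpace Y] {p : Y → X} (hp : Measurable p)
    {u : Y → Ω → ℝ} (hu : Measurable (uncurry u)) : Measurable fun q => ∫ w, u q w ∂κ (p q) := by
  have := (hu.stronglyMeasurable.integral_kernel_prod_right (κ := κ.comap p hp)).measurable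
  simpa only [Kernel.comap_apply] using this

theorem measurable_kcomp_fiber {a b : X → Ω → Ω → ℝ}
    (ha : Measurable fun q : X × Ω × Ω => a q.1 q.2.1 q.2.2)
    (hb : Measurable fun q : X × Ω × Ω => b q.1 q.2.1 q.2.2) :
    Measurable fun q : X × Ω × Ω => kcomp (κ q.1) (a q.1) (b q.1) q.2.1 q.2.2 := by
  refine measurable_integral_fiber (u := fun (q : X × Ω × Ω) w => a q.1 q.2.1 w * b q.1 w q.2.2)
    measurable_fst ?_
  exact (ha.comp (f := fun r : (X × Ω × Ω) × Ω => (r.1.1, r.1.2.1, r.2)) (by fun_prop)).mul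
    (hb.comp (f := fun r : (X × Ω × Ω) × Ω => (r.1.1, r.2, r.1.2.2)) (by fun_prop))

theorem measurable_kpow_fiber {a : X → Ω → Ω → ℝ}
    (ha : Measurable fun q : X × Ω × Ω => a q.1 q.2.1 q.2.2) (n : ℕ) :
    Measurable fun q : X × Ω × Ω => kpow (κ q.1) (a q.1) n q.2.1 q.2.2 := by
  induction n with
  | zero => exact ha
  | succ n ih => exact measurable_kcomp_fiber (b := fun x => kpow (κ x) (a x) n) ha ih

/-- A nonzero symmetric invariant kernel gives rise to a nonzero invariant family of finite rank
projections. -/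
theorem exists_invariant_projection [MeasurableSpace.CountablyGenerated Ω]
    [SMul G X] [SMul G Ω] [MeasurableConstSMul G Ω] [NeZero μ]
    (hE : ErgodicFibration G μ κ) {T : X → Ω → Ω → ℝ}
    (hTm : Measurable fun q : X × Ω × Ω => T q.1 q.2.1 q.2.2)
    (hTb : ∀ x, IsBddMeas (uncurry (T x))) (hTs : ∀ x y z, T x y z = T x z y)
    (hTi : IsInvariantKernel G μ κ T)
    (hT0 : ¬ ∀ᵐ x ∂μ, ∀ᵐ y ∂κ x, ∀ᵐ z ∂κ x, T x y z = 0)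
    (hT1 : ∀ᵐ x ∂μ, ∀ᵐ y ∂κ x, ∫ z, T x y z ∂κ x = 0) :
    ∃ (P : X → Ω → Ω → ℝ) (d : ℝ), (Measurable fun q : X × Ω × Ω => P q.1 q.2.1 q.2.2) ∧
      (∀ x, IsBddMeas (uncurry (P x))) ∧ (∀ x y z, P x y z = P x z y) ∧
      IsInvariantKernel G μ κ P ∧
      (∀ᵐ x ∂μ, ∀ᵐ y ∂κ x, ∀ᵐ z ∂κ x, kcomp (κ x) (P x) (P x) y z = P x y z) ∧ 0 < d ∧
      (∀ᵐ x ∂μ, ∀ᵐ y ∂κ x, ∫ z, P x y z ^ 2 ∂κ x = d) ∧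
      ∀ᵐ x ∂μ, ∀ᵐ y ∂κ x, ∫ z, P x y z ∂κ x = 0 := by
  have hφ : ∀ g : G, Measurable (g • · : Ω → Ω) := fun g => measurable_const_smul g
  have hmap : ∀ g : G, ∀ x, IsProbabilityMeasure ((κ x).map (g • ·)) := fun g x =>
    Measure.isProbabilityMeasure_map (hφ g).aemeasurable
  -- Row norms of powers are invariant functions on the total space, so ergodicity makes them
  -- constants independent of the fibre.
  have hconst : ∀ n, ∃ c, ∀ᵐ x ∂μ, ∀ᵐ y ∂κ x, ∫ z, kpow (κ x) (T x) n y z ^ 2 ∂κ x = c := by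
    intro n
    refine hE.ae_const (fun x y => ∫ z, kpow (κ x) (T x) n y z ^ 2 ∂κ x) ?_ fun g => ?_
    · refine measurable_integral_fiber
        (u := fun (q : X × Ω) z => kpow (κ q.1) (T q.1) n q.2 z ^ 2) measurable_fst ?_
      exact ((measurable_kpow_fiber hTm n).comp
        (f := fun r : (X × Ω) × Ω => (r.1.1, r.1.2, r.2)) (by fun_prop)).pow_const 2
    · filter_upwards [hE.map_smul g, hTi g] with x hx hTx
      have := hmap g x
      rw [hx]
      exact integral_sq_map (hφ g) ((hTb _).kpow _ n) (kpow_map (hφ g) (hTb x) (hTb _) hTx n)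
  choose U hU using hconst
  have hU' : ∀ᵐ x ∂μ, ∀ᵐ y ∂κ x, ∀ n, ∫ z, kpow (κ x) (T x) n y z ^ 2 ∂κ x = U n := by
    filter_upwards [ae_all_iff.2 hU] with x hx
    exact ae_all_iff.2 hx
  obtain ⟨x, hx⟩ := hU'.exists
  obtain ⟨y, hy⟩ := hx.exists
  have hnn : ∀ n, 0 ≤ U n := fun n => hy n ▸ integral_nonneg fun z => sq_nonneg _
  have hconv := fun n => rowNorm_log_convex (hTb x) (hTs x) hy n
  have hsub := rowNorm_submultiplicative (hTb x) (hTs x) hy hx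
  have h0 : U 0 ≠ 0 := by
    intro h
    refine hT0 ?_
    filter_upwards [hU 0] with x hx
    filter_upwards [hx] with y hy
    exact ((hTb x).row y).ae_eq_zero_of_integral_sq _ (hy.trans h)
  have h1 : U 1 ≠ 0 := by
    intro h
    refine hT0 ?_
    filter_upwards [hU 1] with x hx
    exact ae_eq_zero_of_rowNorm_one_eq_zero (hTb x) (hTs x) (by simpa only [h] using hx)
  -- Log-convexity propagates positivity: a zero term would force the preceding one to vanish.
  have hpos : ∀ n, 0 < U n := by
    have : ∀ n, 0 < U (n + 1) := by
      intro n
      induction n with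
      | zero => exact lt_of_le_of_ne (hnn 1) h1.symm
      | succ n ih =>
        refine lt_of_le_of_ne (hnn _) fun h => ?_
        have := hconv n
        rw [show n + 2 = n + 1 + 1 by ring, ← h, mul_zero] at this
        nlinarith
    intro n
    cases n with
    | zero => exact lt_of_le_of_ne (hnn 0) h0.symm
    | succ n => exact this n
  obtain ⟨Λ, d, hΛ, hd, hV⟩ := exists_tendsto_div_pow hpos hconv hsub
  obtain ⟨M, hM⟩ := hV.bddAbove_range
  have hM' : ∀ n, U n / Λ ^ (n + 1) ≤ M := fun n => hM ⟨n, rfl⟩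
  have hVpos : ∀ n, 0 < U n / Λ ^ (n + 1) := fun n => div_pos (hpos n) (by positivity)
  -- The `+ 1` gives `B ≥ 1`, so that the bound required of `B ^ 2` follows from a bound by `B`.
  set B := U 1 / Λ ^ (1 + 1) * M + 1 with hBdef
  have hVM : 0 ≤ U 1 / Λ ^ (1 + 1) * M :=
    mul_nonneg (hVpos 1).le ((hVpos 1).le.trans (hM' 1))
  have hB : 0 ≤ B := by linarith
  have hUB : ∀ n, U 1 / Λ ^ (1 + 1) * (U n / Λ ^ (n + 1)) ≤ B ^ 2 := by
    intro n
    have := mul_le_mul_of_nonneg_left (hM' n) (hVpos 1).le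
    nlinarith
  refine ⟨fun x => spectralLim (κ x) (T x) Λ B, d, ?_, fun x => (hTb x).spectralLim _ hB,
    fun x => spectralLim_symm _ (hTb x) (hTs x), fun g => ?_, ?_, hd, ?_, ?_⟩
  · exact Measurable.limsup fun n => measurable_const.max
      (measurable_const.min ((measurable_kpow_fiber hTm _).div_const _))
  · filter_upwards [hE.map_smul g, hTi g] with x hx hTx
    rw [hx]
    exact spectralLim_map (hφ g) (hTb x) (hTb _) hTx Λ B
  · filter_upwards [hU'] with x hx
    exact kcomp_spectralLim _ (hTb x) (hTs x) hV hB hUB hx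
  · filter_upwards [hU'] with x hx
    exact integral_spectralLim_sq _ (hTb x) (hTs x) hV hB hUB hx
  · filter_upwards [hU', hT1] with x hx h1
    exact integral_spectralLim _ (hTb x) (hTs x) hV hB hUB hx h1

end InvariantKernels

/-! ### Measurable orthonormal frames of finite-rank projections. -/

section Frames

open Filter Topology Function

section Orthonormal

variable {Ω : Type*} [MeasurableSpace Ω] {m : Measure Ω} [IsProbabilityMeasure m]
  {ι : Type*} [Fintype ι] [DecidableEq ι] {f : ι → Ω → ℝ}

theorem integral_sum_mul_of_orthonormal (hf : ∀ i, IsBddMeas (f i))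
    (ho : ∀ i j, ∫ y, f i y * f j y ∂m = if i = j then 1 else 0) (c : ι → ℝ) (i : ι) :
    ∫ y, (∑ j, c j * f j y) * f i y ∂m = c i := by
  have h : ∀ y, (∑ j, c j * f j y) * f i y = ∑ j, c j * (f j y * f i y) := fun y => by
    rw [Finset.sum_mul]
    exact Finset.sum_congr rfl fun j _ => by ring
  simp only [h]
  rw [integral_finsetSum _ fun j _ => (((hf j).mul (hf i)).integrable m).const_mul _]
  simp [integral_const_mul, ho]

end Orthonormal

section RankOne

variable {Ω : Type*} [MeasurableSpace Ω] {m : Measure Ω} [IsProbabilityMeasure m]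
  {P : Ω → Ω → ℝ} {u : Ω → ℝ}

theorem IsBddMeas.sub_rankOne (hP : IsBddMeas (uncurry P)) (hu : IsBddMeas u) :
    IsBddMeas (uncurry fun y z => P y z - u y * u z) :=
  hP.sub ((hu.comp measurable_fst).mul (hu.comp measurable_snd))

theorem kcomp_sub_rankOne (hP : IsBddMeas (uncurry P)) (hs : ∀ y z, P y z = P z y)
    (hu : IsBddMeas u) (hPP : ∀ᵐ y ∂m, ∀ᵐ z ∂m, kcomp m P P y z = P y z)
    (hu1 : ∫ y, u y ^ 2 ∂m = 1) (hPu : ∀ᵐ y ∂m, ∫ z, P y z * u z ∂m = u y) :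
    ∀ᵐ y ∂m, ∀ᵐ z ∂m, kcomp m (fun y z => P y z - u y * u z) (fun y z => P y z - u y * u z) y z
      = P y z - u y * u z := by
  filter_upwards [hPP, hPu] with y hy1 hy2
  filter_upwards [hy1, hPu] with z hz1 hz2
  have i1 := ((hP.row y).mul (hP.col z)).integrable m
  have i2 := (((hP.row y).mul hu).mul (.const (u z))).integrable m
  have i3 := ((IsBddMeas.const (u y)).mul ((hP.row z).mul hu)).integrable m
  have i4 := ((IsBddMeas.const (u y * u z)).mul hu.sq).integrable m
  calc _ = ∫ w, ((P y w * P w z - P y w * u w * u z) - u y * (P z w * u w))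
        + (u y * u z) * u w ^ 2 ∂m :=
        integral_congr_ae (Eventually.of_forall fun w => by simp only [hs w z]; ring)
    _ = (((∫ w, P y w * P w z ∂m) - (∫ w, P y w * u w * u z ∂m)) - ∫ w, u y * (P z w * u w) ∂m)
        + ∫ w, (u y * u z) * u w ^ 2 ∂m := by
        rw [← integral_sub i1 i2]
        refine (integral_add ((i1.sub i2).sub i3) i4).trans ?_
        congr 1
        exact integral_sub (i1.sub i2) i3
    _ = P y z - u y * u z := by
        rw [integral_mul_const, integral_const_mul, integral_const_mul, hy2, hz2, hu1,
          show ∫ w, P y w * P w z ∂m = P y z from hz1]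
        ring

theorem integral_sub_rankOne_mul (hP : IsBddMeas (uncurry P))
    (hu : IsBddMeas u) (hu1 : ∫ y, u y ^ 2 ∂m = 1) (hPu : ∀ᵐ y ∂m, ∫ z, P y z * u z ∂m = u y) :
    ∀ᵐ y ∂m, ∫ z, (P y z - u y * u z) * u z ∂m = 0 := by
  filter_upwards [hPu] with y hy
  have i1 := ((hP.row y).mul hu).integrable m
  have i2 := ((IsBddMeas.const (u y)).mul hu.sq).integrable m
  calc _ = ∫ z, P y z * u z - u y * u z ^ 2 ∂m :=
        integral_congr_ae (Eventually.of_forall fun w => by ring)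
    _ = 0 := by rw [integral_sub i1 i2, integral_const_mul, hy, hu1]; ring

/-- For a unit vector fixed by `P`, the cross term is `-2` and the square term `+1`. This unit drop
in squared Hilbert–Schmidt norm drives the induction for frames. -/
theorem integral_integral_sub_rankOne_sq (hP : IsBddMeas (uncurry P))
    (hu : IsBddMeas u) (hu1 : ∫ y, u y ^ 2 ∂m = 1) (hPu : ∀ᵐ y ∂m, ∫ z, P y z * u z ∂m = u y) :
    ∫ y, ∫ z, (P y z - u y * u z) ^ 2 ∂m ∂m = (∫ y, ∫ z, P y z ^ 2 ∂m ∂m) - 1 := by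
  have hsq : IsBddMeas (uncurry fun y z => P y z ^ 2) := hP.sq
  have h : ∀ᵐ y ∂m, ∫ z, (P y z - u y * u z) ^ 2 ∂m = (∫ z, P y z ^ 2 ∂m) - u y ^ 2 := by
    filter_upwards [hPu] with y hy
    have i1 := (hP.row y).sq.integrable m
    have i2 := ((IsBddMeas.const (2 * u y)).mul ((hP.row y).mul hu)).integrable m
    have i3 := ((IsBddMeas.const (u y ^ 2)).mul hu.sq).integrable m
    calc _ = ∫ z, (P y z ^ 2 - 2 * u y * (P y z * u z)) + u y ^ 2 * u z ^ 2 ∂m :=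
          integral_congr_ae (Eventually.of_forall fun w => by ring)
      _ = ((∫ z, P y z ^ 2 ∂m) - ∫ z, 2 * u y * (P y z * u z) ∂m) + ∫ z, u y ^ 2 * u z ^ 2 ∂m := by
          rw [← integral_sub i1 i2]
          exact integral_add (i1.sub i2) i3
      _ = _ := by rw [integral_const_mul, integral_const_mul, hy, hu1]; ring
  rw [integral_congr_ae h, integral_sub ((hsq.integral_right m).integrable m) (hu.sq.integrable m),
    hu1]

end RankOne

variable {X Ω : Type*} [MeasurableSpace X] [MeasurableSpace Ω]
  {μ : Measure X} {κ : Kernel X Ω} [IsMarkovKernel κ]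

/-- A nonzero measurable family of projections has a measurable section of unit vectors. -/
theorem exists_unit_section [MeasurableSpace.CountablyGenerated Ω] {P : X → Ω → Ω → ℝ} {t : ℝ}
    (hPm : Measurable fun q : X × Ω × Ω => P q.1 q.2.1 q.2.2)
    (hPb : ∀ x, IsBddMeas (uncurry (P x)))
    (hPP : ∀ᵐ x ∂μ, ∀ᵐ y ∂κ x, ∀ᵐ z ∂κ x, kcomp (κ x) (P x) (P x) y z = P x y z) (ht : t ≠ 0)
    (hPt : ∀ᵐ x ∂μ, ∫ y, ∫ z, P x y z ^ 2 ∂κ x ∂κ x = t) :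
    ∃ u : X → Ω → ℝ, Measurable (uncurry u) ∧ (∀ x, IsBddMeas (u x)) ∧
      ∀ᵐ x ∂μ, ∫ y, u x y ^ 2 ∂κ x = 1 ∧ ∀ᵐ y ∂κ x, ∫ z, P x y z * u x z ∂κ x = u x y := by
  classical
  obtain ⟨e, hem, he⟩ := exists_seq_integral_separating Ω
  set E : ℕ → Ω → ℝ := fun n => (e n).indicator (fun _ => (1 : ℝ)) with hE
  have hEb : ∀ n, IsBddMeas (E n) := fun n => .indicator (hem n)
  set h : ℕ → X → Ω → ℝ := fun n x y => ∫ z, P x y z * E n z ∂κ x with hh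
  have hhm : ∀ n, Measurable (uncurry (h n)) := fun n =>
    measurable_integral_fiber (u := fun (q : X × Ω) z => P q.1 q.2 z * E n z) measurable_fst
      ((hPm.comp (f := fun r : (X × Ω) × Ω => (r.1.1, r.1.2, r.2)) (by fun_prop)).mul
        ((hEb n).1.comp measurable_snd))
  have hhb : ∀ n x, IsBddMeas (h n x) := fun n x =>
    IsBddMeas.integral_right (a := fun y z => P x y z * E n z)
      ((hPb x).mul ((hEb n).comp measurable_snd)) (κ x)
  set q : ℕ → X → ℝ := fun n x => ∫ y, h n x y ^ 2 ∂κ x with hq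
  have hqm : ∀ n, Measurable (q n) := fun n =>
    measurable_integral_fiber (u := fun x y => h n x y ^ 2) measurable_id ((hhm n).pow_const 2)
  have hqnn : ∀ n x, 0 ≤ q n x := fun n x => integral_nonneg fun y => sq_nonneg _
  -- The section is the normalised image under `P x` of the first test set on which it is nonzero;
  -- the second alternative makes the search total.
  set p : ℕ → X → Prop := fun n x => 0 < q n x ∨ ∀ k, ¬ 0 < q k x with hp
  have hpm : ∀ n, MeasurableSet {x | p n x} := fun n => by
    have : {x | p n x} = {x | 0 < q n x} ∪ ⋂ k, {x | 0 < q k x}ᶜ := by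
      ext
      simp [hp]
    rw [this]
    exact (measurableSet_lt measurable_const (hqm n)).union
      (MeasurableSet.iInter fun k => (measurableSet_lt measurable_const (hqm k)).compl)
  have hex : ∀ x, ∃ n, p n x := by
    intro x
    by_cases hx : ∃ k, 0 < q k x
    · exact hx.imp fun n hn => Or.inl hn
    · exact ⟨0, Or.inr (not_exists.1 hx)⟩
  refine ⟨fun x y => h (Nat.find (hex x)) x y / √(q (Nat.find (hex x)) x), ?_, fun x => ?_, ?_⟩
  · exact Measurable.find (f := fun n (r : X × Ω) => h n r.1 r.2 / √(q n r.1))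
      (p := fun n r => p n r.1) (fun n => (hhm n).div ((hqm n).comp measurable_fst).sqrt)
      (fun n => measurable_fst (hpm n)) fun r => hex r.1
  · simpa only [div_eq_mul_inv] using (hhb _ x).mul (.const _)
  · filter_upwards [hPP, hPt] with x hx hxt
    have hpos : 0 < q (Nat.find (hex x)) x := by
      -- If every test function were killed, the rows of `P x` would vanish, contrary to `t ≠ 0`.
      refine (Nat.find_spec (hex x)).resolve_right fun hall => ht ?_
      have h0 : ∀ n, ∀ᵐ y ∂κ x, h n x y = 0 := fun n =>
        (hhb n x).ae_eq_zero_of_integral_sq _ (le_antisymm (not_lt.1 (hall n)) (hqnn n x))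
      rw [← hxt]
      refine integral_eq_zero_of_ae ?_
      filter_upwards [ae_all_iff.2 h0] with y hy
      refine integral_eq_zero_of_ae ?_
      filter_upwards [he (κ x) (P x y) ((hPb x).row y) hy] with z hz
      simp [hz]
    generalize Nat.find (hex x) = n at hpos ⊢
    refine ⟨?_, ?_⟩
    · simp only [div_pow, Real.sq_sqrt hpos.le, integral_div]
      exact div_self hpos.ne'
    · filter_upwards [hx] with y hy
      simp only [← mul_div_assoc, integral_div]
      congr 1
      have hc := congrFun (congrFun (kcomp_assoc (κ x) (hPb x) (hPb x)
        (c := fun z _ => E n z) ((hEb n).comp measurable_fst)) y) y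
      change _ = ∫ z, P x y z * h n x z ∂κ x at hc
      rw [← hc]
      refine integral_congr_ae ?_
      filter_upwards [hy] with z hz
      simp only [hz]

/-- A measurable family of finite rank projections has a measurable orthonormal frame. -/
theorem exists_orthonormal_frame [MeasurableSpace.CountablyGenerated Ω] [NeZero μ] (N : ℕ) :
    ∀ {P : X → Ω → Ω → ℝ} {t : ℝ}, t < N →
    (Measurable fun q : X × Ω × Ω => P q.1 q.2.1 q.2.2) →
    (∀ x, IsBddMeas (uncurry (P x))) → (∀ x y z, P x y z = P x z y) →
    (∀ᵐ x ∂μ, ∀ᵐ y ∂κ x, ∀ᵐ z ∂κ x, kcomp (κ x) (P x) (P x) y z = P x y z) →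
    (∀ᵐ x ∂μ, ∫ y, ∫ z, P x y z ^ 2 ∂κ x ∂κ x = t) →
    ∃ (d : ℕ) (f : Fin d → X → Ω → ℝ), (∀ i, Measurable (uncurry (f i))) ∧
      (∀ i x, IsBddMeas (f i x)) ∧
      ∀ᵐ x ∂μ, (∀ i j, ∫ y, f i x y * f j x y ∂κ x = if i = j then 1 else 0) ∧
        ∀ᵐ y ∂κ x, ∀ᵐ z ∂κ x, P x y z = ∑ i, f i x y * f i x z := by
  induction N with
  | zero =>
    intro P t htN _ _ _ _ hPt
    obtain ⟨x, hx⟩ := hPt.exists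
    have : 0 ≤ t := hx ▸ integral_nonneg fun y => integral_nonneg fun z => sq_nonneg _
    exact absurd htN (by simpa using this)
  | succ N ih =>
    intro P t htN hPm hPb hPs hPP hPt
    by_cases ht : t = 0
    · refine ⟨0, Fin.elim0, fun i => i.elim0, fun i => i.elim0, ?_⟩
      filter_upwards [hPt] with x hx
      refine ⟨fun i => i.elim0, ?_⟩
      have hsq : IsBddMeas (uncurry fun y z => P x y z ^ 2) := (hPb x).sq
      have := (integral_eq_zero_iff_of_nonneg
        (fun y => integral_nonneg fun z => sq_nonneg (P x y z))
        ((hsq.integral_right (κ x)).integrable (κ x))).1 (hx.trans ht)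
      filter_upwards [this] with y hy
      filter_upwards [((hPb x).row y).ae_eq_zero_of_integral_sq _ hy] with z hz
      simpa using hz
    · obtain ⟨u, hum, hub, hu⟩ := exists_unit_section hPm hPb hPP ht hPt
      -- Peeling off `u` lowers `t` by one. Integrality of `t` need not be known beforehand: the
      -- case `N = 0` is excluded by `0 ≤ t`.
      obtain ⟨d, f, hfm, hfb, hf⟩ := ih (P := fun x y z => P x y z - u x y * u x z) (t := t - 1)
        (by push_cast at htN; linarith)
        (hPm.sub ((hum.comp (f := fun q : X × Ω × Ω => (q.1, q.2.1)) (by fun_prop)).mul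
          (hum.comp (f := fun q : X × Ω × Ω => (q.1, q.2.2)) (by fun_prop))))
        (fun x => (hPb x).sub_rankOne (hub x))
        (fun x y z => by rw [hPs x y z, mul_comm])
        (by
          filter_upwards [hPP, hu] with x h1 h2
          exact kcomp_sub_rankOne (hPb x) (hPs x) (hub x) h1 h2.1 h2.2)
        (by
          filter_upwards [hPt, hu] with x h1 h2
          rw [integral_integral_sub_rankOne_sq (hPb x) (hub x) h2.1 h2.2, h1])
      refine ⟨d + 1, Fin.cons u f, fun i => Fin.cases hum hfm i, fun i => Fin.cases hub hfb i, ?_⟩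
      filter_upwards [hu, hf] with x hux hfx
      -- The reduced projection kills `u`, so `∑ ⟨f j, u⟩ f j = 0`, and orthonormality makes each
      -- coefficient zero.
      have horth : ∀ i, ∫ y, u x y * f i x y ∂κ x = 0 := by
        set c : Fin d → ℝ := fun j => ∫ z, f j x z * u x z ∂κ x with hc
        have h0 : ∀ᵐ y ∂κ x, ∑ j, c j * f j x y = 0 := by
          filter_upwards [integral_sub_rankOne_mul (hPb x) (hub x) hux.1 hux.2, hfx.2] with y h1 h2
          rw [← h1]
          have : ∫ z, (P x y z - u x y * u x z) * u x z ∂κ x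
              = ∫ z, ∑ j, f j x y * (f j x z * u x z) ∂κ x := by
            refine integral_congr_ae ?_
            filter_upwards [h2] with z hz
            simp only [hz, Finset.sum_mul, mul_assoc]
          rw [this, integral_finsetSum _ fun j _ =>
            (((hfb j x).mul (hub x)).integrable _).const_mul _]
          simp only [integral_const_mul, hc, mul_comm]
        intro i
        have h1 := integral_sum_mul_of_orthonormal (fun j => hfb j x) hfx.1 c i
        have h2 : ∫ y, (∑ j, c j * f j x y) * f i x y ∂κ x = 0 := by
          refine integral_eq_zero_of_ae ?_
          filter_upwards [h0] with y hy
          simp [hy]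
        rw [h2, hc] at h1
        simp only [mul_comm (u x _)]
        exact h1.symm
      refine ⟨fun i j => ?_, ?_⟩
      · refine Fin.cases ?_ (fun i => ?_) i <;> refine Fin.cases ?_ (fun j => ?_) j
        · simpa [← _root_.sq] using hux.1
        · simpa [(Fin.succ_ne_zero j).symm] using horth j
        · simpa [Fin.succ_ne_zero i, mul_comm] using horth i
        · simpa using hfx.1 i j
      · filter_upwards [hfx.2] with y hy
        filter_upwards [hy] with z hz
        rw [Fin.sum_univ_succ]
        simp only [Fin.cons_zero, Fin.cons_succ, ← hz]
        ring

end Frames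

/-! ### The orthogonal cocycle of a frame and its straightening. -/

section OrthogonalCocycles

open Filter Topology Function Matrix

section Compact

variable (d : ℕ)

theorem compactSpace_orthogonalGroup : CompactSpace (Matrix.orthogonalGroup (Fin d) ℝ) := by
  refine isCompact_iff_compactSpace.1 ?_
  have hK : IsCompact (Set.univ.pi fun _ : Fin d => Set.univ.pi fun _ : Fin d =>
      Set.Icc (-1 : ℝ) 1) :=
    isCompact_univ_pi fun _ => isCompact_univ_pi fun _ => isCompact_Icc
  refine IsCompact.of_isClosed_subset (X := Matrix (Fin d) (Fin d) ℝ) hK ?_ fun A hA => ?_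
  · have : (Matrix.orthogonalGroup (Fin d) ℝ : Set (Matrix (Fin d) (Fin d) ℝ))
        = {A | A * Aᵀ = 1} := by
      ext A
      exact Matrix.mem_orthogonalGroup_iff _ _
    rw [this]
    exact isClosed_eq (by fun_prop) continuous_const
  · exact fun i _ j _ => abs_le.1 (entry_norm_bound_of_unitary hA i j)

end Compact

variable {G X Ω : Type*} [Group G] [MeasurableSpace G] [MeasurableSpace X] [MulAction G X]
  {μ : Measure X} {d : ℕ}

/-- Cocycle superrigidity for almost everywhere orthogonal matrix valued cocycles. -/
theorem IsCompactCocycleSuperrigid.exists_orthogonal [MeasurableConstSMul G X]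
    [SMulInvariantMeasure G X μ]
    (hX : IsCompactCocycleSuperrigid G μ) {α : G → X → Matrix (Fin d) (Fin d) ℝ}
    (hα : ∀ i j, Measurable fun q : G × X => α q.1 q.2 i j)
    (horth : ∀ g, ∀ᵐ x ∂μ, α g x * (α g x)ᵀ = 1)
    (hmul : ∀ g h, ∀ᵐ x ∂μ, α (g * h) x = α g (h • x) * α h x) :
    ∃ (φ : X → Matrix (Fin d) (Fin d) ℝ) (ρ : G → Matrix (Fin d) (Fin d) ℝ),
      (∀ i j, Measurable fun x => φ x i j) ∧ (∀ x, φ x * (φ x)ᵀ = 1) ∧ (∀ g, ρ g * (ρ g)ᵀ = 1) ∧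
      ∀ g, ∀ᵐ x ∂μ, α g x = φ (g • x) * ρ g * (φ x)ᵀ := by
  classical
  let : MeasurableSpace (Matrix (Fin d) (Fin d) ℝ) :=
    inferInstanceAs (MeasurableSpace (Fin d → Fin d → ℝ))
  have : BorelSpace (Matrix (Fin d) (Fin d) ℝ) :=
    inferInstanceAs (BorelSpace (Fin d → Fin d → ℝ))
  have : SecondCountableTopology (Matrix (Fin d) (Fin d) ℝ) :=
    inferInstanceAs (SecondCountableTopology (Fin d → Fin d → ℝ))
  have : MeasurableEq (Matrix (Fin d) (Fin d) ℝ) :=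
    inferInstanceAs (MeasurableEq (Fin d → Fin d → ℝ))
  have := compactSpace_orthogonalGroup d
  have hpi : ∀ {Y : Type _} [MeasurableSpace Y] {u : Y → Matrix (Fin d) (Fin d) ℝ},
      (∀ i j, Measurable fun y => u y i j) → Measurable u := fun h =>
    measurable_pi_iff.2 fun i => measurable_pi_iff.2 fun j => h i j
  let L := Matrix.orthogonalGroup (Fin d) ℝ
  have : SecondCountableTopology L := TopologicalSpace.Subtype.secondCountableTopology _
  have hmem : ∀ A : Matrix (Fin d) (Fin d) ℝ, (if A * Aᵀ = 1 then A else 1) ∈ L := fun A => by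
    split_ifs with h
    · exact (Matrix.mem_orthogonalGroup_iff _ _).2 h
    · exact one_mem _
  -- Orthogonality holds only almost everywhere for each `g`; the value `1` elsewhere gives a
  -- measurable map into the group without affecting the cocycle identity almost everywhere.
  let β : G → X → L := fun g x => ⟨if α g x * (α g x)ᵀ = 1 then α g x else 1, hmem _⟩
  have hβ : ∀ g x, α g x * (α g x)ᵀ = 1 → (β g x : Matrix (Fin d) (Fin d) ℝ) = α g x :=
    fun g x h => if_pos h
  have hset : MeasurableSet {q : G × X | α q.1 q.2 * (α q.1 q.2)ᵀ = 1} := by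
    refine measurableSet_eq_fun (hpi fun i j => ?_) measurable_const
    simp only [Matrix.mul_apply, Matrix.transpose_apply]
    exact Finset.measurable_sum _ fun k _ => (hα i k).mul (hα j k)
  have hcoc : IsMeasurableCocycle μ β := by
    refine ⟨(Measurable.ite hset (hpi hα) measurable_const).subtype_mk, fun g h => ?_⟩
    filter_upwards [hmul g h, horth (g * h), horth h,
      (measurePreserving_smul h μ).quasiMeasurePreserving.ae (horth g)] with x h1 h2 h3 h4
    refine Subtype.ext ?_
    rw [hβ _ _ h2, h1]
    simp only [Submonoid.coe_mul, hβ _ _ h3, hβ _ _ h4]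
  obtain ⟨φ, ρ, hφ, h⟩ := (hX L).2 β hcoc
  refine ⟨fun x => φ x, fun g => ρ g, fun i j => ?_,
    fun x => (Matrix.mem_orthogonalGroup_iff _ _).1 (φ x).2,
    fun g => (Matrix.mem_orthogonalGroup_iff _ _).1 (ρ g).2, fun g => ?_⟩
  · exact measurable_pi_iff.1 (measurable_pi_iff.1 (measurable_subtype_coe.comp hφ) i) j
  · filter_upwards [h g, horth g] with x h1 h2
    rw [← hβ _ _ h2, h1]
    rfl

section FrameTransport

variable {Ω : Type*} [MeasurableSpace Ω] {m : Measure Ω} [IsProbabilityMeasure m] {φ : Ω → Ω}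
  {f f' : Fin d → Ω → ℝ} (hφ : Measurable φ) (hf : ∀ i, IsBddMeas (f i))
  (hf' : ∀ i, IsBddMeas (f' i))
  (ho' : ∀ i j, ∫ y, f' i y * f' j y ∂(m.map φ) = if i = j then 1 else 0)

-- Both frames represent the same kernel. It reproduces `f' i`, and writing it through `f` instead
-- gives the expansion.
include hφ hf hf' ho' in
theorem ae_frame_eq_sum
    (h : ∀ᵐ y ∂m, ∀ᵐ z ∂m, ∑ i, f' i (φ y) * f' i (φ z) = ∑ i, f i y * f i z) :
    ∀ᵐ y ∂m, ∀ i, f' i (φ y) = ∑ j, (∫ z, f' i (φ z) * f j z ∂m) * f j y := by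
  have : IsProbabilityMeasure (m.map φ) := Measure.isProbabilityMeasure_map hφ.aemeasurable
  filter_upwards [h] with y hy i
  have h1 := integral_sum_mul_of_orthonormal hf' ho' (fun i => f' i (φ y)) i
  rw [integral_map hφ.aemeasurable
    ((IsBddMeas.sum _ fun i => (IsBddMeas.const _).mul (hf' i)).mul
      (hf' i)).1.aestronglyMeasurable] at h1
  rw [← h1]
  calc _ = ∫ z, ∑ j, f j y * (f' i (φ z) * f j z) ∂m := by
        refine integral_congr_ae ?_
        filter_upwards [hy] with z hz
        simp only [hz, Finset.sum_mul]
        exact Finset.sum_congr rfl fun j _ => by ring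
    _ = _ := by
        rw [integral_finsetSum _ fun j _ =>
          ((((hf' i).comp hφ).mul (hf j)).integrable m).const_mul _]
        simp only [integral_const_mul]
        exact Finset.sum_congr rfl fun j _ => mul_comm _ _

-- The product of the coefficient matrix with its transpose is the Gram matrix of the transported
-- frame, by Parseval.
include hφ hf hf' ho' in
theorem frame_matrix_orthogonal
    (h : ∀ᵐ y ∂m, ∀ i, f' i (φ y) = ∑ j, (∫ z, f' i (φ z) * f j z ∂m) * f j y) :
    (Matrix.of fun i j => ∫ z, f' i (φ z) * f j z ∂m)
      * (Matrix.of fun i j => ∫ z, f' i (φ z) * f j z ∂m)ᵀ = 1 := by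
  ext i k
  have h1 := ho' i k
  rw [integral_map hφ.aemeasurable ((hf' i).mul (hf' k)).1.aestronglyMeasurable] at h1
  rw [Matrix.one_apply, ← h1, Matrix.mul_apply]
  simp only [Matrix.transpose_apply, Matrix.of_apply]
  calc _ = ∫ y, ∑ j, (∫ z, f' i (φ z) * f j z ∂m) * (f' k (φ y) * f j y) ∂m := by
        rw [integral_finsetSum _ fun j _ =>
          ((((hf' k).comp hφ).mul (hf j)).integrable m).const_mul _]
        simp only [integral_const_mul]
    _ = _ := by
        refine integral_congr_ae ?_
        filter_upwards [h] with y hy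
        rw [hy i, Finset.sum_mul]
        exact Finset.sum_congr rfl fun j _ => by ring

theorem eq_of_ae_sum_eq (hf : ∀ i, IsBddMeas (f i))
    (ho : ∀ i j, ∫ y, f i y * f j y ∂m = if i = j then 1 else 0) {A B : Matrix (Fin d) (Fin d) ℝ}
    (h : ∀ᵐ y ∂m, ∀ i, ∑ j, A i j * f j y = ∑ j, B i j * f j y) : A = B := by
  ext i j
  rw [← integral_sum_mul_of_orthonormal hf ho (A i) j,
    ← integral_sum_mul_of_orthonormal hf ho (B i) j]
  refine integral_congr_ae ?_
  filter_upwards [h] with y hy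
  simp only [hy i]

end FrameTransport

/-- An orthonormal frame of an invariant family of finite rank projections can be rotated, by
superrigidity, so that `G` acts on it through constant orthogonal matrices. -/
theorem exists_equivariant_frame [MeasurableSpace Ω] [MulAction G Ω] [MeasurableSMul₂ G X]
    [MeasurableSMul₂ G Ω] [SMulInvariantMeasure G X μ] {κ : Kernel X Ω} [IsMarkovKernel κ]
    (hX : IsCompactCocycleSuperrigid G μ) (hE : ErgodicFibration G μ κ) {P : X → Ω → Ω → ℝ}
    (hPi : IsInvariantKernel G μ κ P)
    {f : Fin d → X → Ω → ℝ} (hfm : ∀ i, Measurable (uncurry (f i)))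
    (hfb : ∀ i x, IsBddMeas (f i x))
    (hfo : ∀ᵐ x ∂μ, ∀ i j, ∫ y, f i x y * f j x y ∂κ x = if i = j then 1 else 0)
    (hfP : ∀ᵐ x ∂μ, ∀ᵐ y ∂κ x, ∀ᵐ z ∂κ x, P x y z = ∑ i, f i x y * f i x z) :
    ∃ (φ : X → Matrix (Fin d) (Fin d) ℝ) (ρ : G → Matrix (Fin d) (Fin d) ℝ),
      (∀ i j, Measurable fun x => φ x i j) ∧ (∀ x, φ x * (φ x)ᵀ = 1) ∧ (∀ g, ρ g * (ρ g)ᵀ = 1) ∧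
      ∀ g, ∀ᵐ x ∂μ, ∀ᵐ y ∂κ x, (φ (g • x))ᵀ *ᵥ (fun i => f i (g • x) (g • y))
        = ρ g *ᵥ ((φ x)ᵀ *ᵥ fun i => f i x y) := by
  have hψ : ∀ g : G, Measurable (g • · : Ω → Ω) := fun g => measurable_const_smul g
  have hqmp : ∀ g : G, Measure.QuasiMeasurePreserving (g • · : X → X) μ μ := fun g =>
    (measurePreserving_smul g μ).quasiMeasurePreserving
  set α : G → X → Matrix (Fin d) (Fin d) ℝ := fun g x =>
    Matrix.of fun i j => ∫ z, f i (g • x) (g • z) * f j x z ∂κ x with hα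
  have hsum : ∀ g, ∀ᵐ x ∂μ, ∀ᵐ y ∂κ x, ∀ i, f i (g • x) (g • y) = ∑ j, α g x i j * f j x y := by
    intro g
    filter_upwards [hE.map_smul g, hPi g, hfP, (hqmp g).ae hfP, (hqmp g).ae hfo]
      with x h1 h2 h3 h4 h5
    rw [h1] at h4 h5
    refine ae_frame_eq_sum (hψ g) (fun i => hfb i x) (fun i => hfb i (g • x)) h5 ?_
    have h6 : ∀ᵐ y ∂κ x, ∀ᵐ z ∂κ x,
        P (g • x) (g • y) (g • z) = ∑ i, f i (g • x) (g • y) * f i (g • x) (g • z) := by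
      filter_upwards [ae_of_ae_map (hψ g).aemeasurable h4] with y hy
      exact ae_of_ae_map (hψ g).aemeasurable hy
    filter_upwards [h2, h3, h6] with y a1 a2 a3
    filter_upwards [a1, a2, a3] with z b1 b2 b3
    rw [← b3, b1, b2]
  have hαm : ∀ i j, Measurable fun q : G × X => α q.1 q.2 i j := fun i j => by
    refine measurable_integral_fiber
      (u := fun (q : G × X) z => f i (q.1 • q.2) (q.1 • z) * f j q.2 z) measurable_snd ?_
    exact ((hfm i).comp (f := fun r : (G × X) × Ω => (r.1.1 • r.1.2, r.1.1 • r.2))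
      (by fun_prop)).mul ((hfm j).comp (f := fun r : (G × X) × Ω => (r.1.2, r.2)) (by fun_prop))
  have horth : ∀ g, ∀ᵐ x ∂μ, α g x * (α g x)ᵀ = 1 := by
    intro g
    filter_upwards [hE.map_smul g, (hqmp g).ae hfo, hsum g] with x h1 h2 h3
    rw [h1] at h2
    exact frame_matrix_orthogonal (hψ g) (fun i => hfb i x) (fun i => hfb i (g • x)) h2 h3
  -- Expand the frame at `(g * h) • y` directly and through `h • y`; coefficients in an orthonormal
  -- frame are unique.
  have hmul : ∀ g h, ∀ᵐ x ∂μ, α (g * h) x = α g (h • x) * α h x := by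
    intro g h
    filter_upwards [hfo, hsum (g * h), hsum h, (hqmp h).ae (hsum g), hE.map_smul h]
      with x h0 h1 h2 h3 h4
    rw [h4] at h3
    refine eq_of_ae_sum_eq (fun i => hfb i x) h0 ?_
    filter_upwards [h1, h2, ae_of_ae_map (hψ h).aemeasurable h3] with y a1 a2 a3 i
    rw [← a1 i, mul_smul, mul_smul, a3 i]
    simp only [a2, Matrix.mul_apply, Finset.mul_sum, Finset.sum_mul, mul_assoc]
    exact Finset.sum_comm
  obtain ⟨φ, ρ, hφm, hφ, hρ, h⟩ := hX.exists_orthogonal hαm horth hmul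
  refine ⟨φ, ρ, hφm, hφ, hρ, fun g => ?_⟩
  filter_upwards [h g, hsum g] with x h1 h2
  filter_upwards [h2] with y hy
  have : (fun i => f i (g • x) (g • y)) = α g x *ᵥ fun i => f i x y := by
    funext i
    rw [hy i]
    rfl
  rw [this, h1, Matrix.mulVec_mulVec, Matrix.mulVec_mulVec, ← Matrix.mul_assoc,
    ← Matrix.mul_assoc, mul_eq_one_comm.1 (hφ (g • x)), Matrix.one_mul]

end OrthogonalCocycles

/-! ### Consequences of ergodicity and weak mixing. -/

section Ergodicity

open Filter Topology Function Matrix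

/-- An almost everywhere invariant real function of an ergodic action is constant. -/
theorem ErgodicSMul.ae_const_of_ae_invariant {G Y : Type*} [SMul G Y] [MeasurableSpace Y]
    {m : Measure Y} [ErgodicSMul G Y m] {r : Y → ℝ} (hr : Measurable r)
    (h : ∀ g : G, ∀ᵐ y ∂m, r (g • y) = r y) : ∃ c, ∀ᵐ y ∂m, r y = c := by
  refine exists_eventuallyEq_const_of_forall_separating (l := ae m) (f := r) MeasurableSet
    fun U hU => ?_
  refine eventuallyConst_set.1 (ErgodicSMul.aeconst_of_forall_preimage_smul_ae_eq (G := G)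
    (s := r ⁻¹' U) (hr hU) fun g => ?_)
  filter_upwards [h g] with y hy
  refine propext ?_
  change r (g • y) ∈ U ↔ r y ∈ U
  rw [hy]

/-- Apply ergodicity of the square to the cylinder `s × Y`. -/
theorem IsWeaklyMixing.ergodicSMul {G Y : Type*} [Group G] [MeasurableSpace Y] [MulAction G Y]
    {m : Measure Y} [IsProbabilityMeasure m] [SMulInvariantMeasure G Y m]
    (h : IsWeaklyMixing G m) : ErgodicSMul G Y m := by
  refine ⟨fun {s} hs hinv => ?_⟩
  have h1 := h.aeconst_of_forall_preimage_smul_ae_eq (s := Prod.fst ⁻¹' s) (measurable_fst hs)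
    fun g => Measure.quasiMeasurePreserving_fst.preimage_ae_eq (hinv g)
  rw [eventuallyConst_set] at h1 ⊢
  refine h1.imp (fun h => ?_) fun h => ?_ <;>
  · filter_upwards [Measure.ae_ae_of_ae_prod h] with y hy
    exact hy.exists.choose_spec

theorem dotProduct_mulVec_self_of_orthogonal {d : ℕ} {A : Matrix (Fin d) (Fin d) ℝ}
    (hA : A * Aᵀ = 1) (u : Fin d → ℝ) : (A *ᵥ u) ⬝ᵥ (A *ᵥ u) = u ⬝ᵥ u := by
  rw [Matrix.dotProduct_mulVec, ← Matrix.mulVec_transpose, Matrix.mulVec_mulVec,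
    mul_eq_one_comm.1 hA, Matrix.one_mulVec]

/-- A weakly mixing action has no nonconstant equivariant maps to orthogonal representations. -/
theorem IsWeaklyMixing.ae_const_of_orthogonal {G Y : Type*} [Group G] [MeasurableSpace Y]
    [MulAction G Y] [MeasurableConstSMul G Y] {m : Measure Y} [IsProbabilityMeasure m]
    [SMulInvariantMeasure G Y m] (h : IsWeaklyMixing G m) {d : ℕ} {Φ : Y → Fin d → ℝ}
    (hΦ : Measurable Φ) {ρ : G → Matrix (Fin d) (Fin d) ℝ} (hρ : ∀ g, ρ g * (ρ g)ᵀ = 1)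
    (hinv : ∀ g, ∀ᵐ y ∂m, Φ (g • y) = ρ g *ᵥ Φ y) : ∃ v, ∀ᵐ y ∂m, Φ y = v := by
  have : ErgodicSMul G (Y × Y) (m.prod m) := h
  have hΦi : ∀ i, Measurable fun y => Φ y i := fun i => measurable_pi_iff.1 hΦ i
  -- The squared distance between the values of `Φ` at two points is invariant under the diagonal
  -- action because `ρ` is orthogonal.
  obtain ⟨δ, hδ⟩ := ErgodicSMul.ae_const_of_ae_invariant (G := G) (m := m.prod m)
    (r := fun q => (Φ q.1 - Φ q.2) ⬝ᵥ (Φ q.1 - Φ q.2))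
    (by
      simp only [dotProduct, Pi.sub_apply]
      exact Finset.measurable_sum _ fun i _ =>
        (((hΦi i).comp measurable_fst).sub ((hΦi i).comp measurable_snd)).mul
          (((hΦi i).comp measurable_fst).sub ((hΦi i).comp measurable_snd)))
    (fun g => by
      filter_upwards [Measure.quasiMeasurePreserving_fst.ae (hinv g),
        Measure.quasiMeasurePreserving_snd.ae (hinv g)] with q h1 h2
      rw [Prod.smul_fst, Prod.smul_snd, h1, h2, ← Matrix.mulVec_sub,
        dotProduct_mulVec_self_of_orthogonal (hρ g)])
  have hδ' := Measure.ae_ae_of_ae_prod hδ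
  by_cases h0 : δ = 0
  · obtain ⟨y, hy⟩ := hδ'.exists
    refine ⟨Φ y, ?_⟩
    filter_upwards [hy] with z hz
    rw [h0] at hz
    exact (sub_eq_zero.1 (dotProduct_self_eq_zero.1 hz)).symm
  · exfalso
    have hpos : 0 < δ := by
      obtain ⟨q, hq⟩ := hδ.exists
      refine lt_of_le_of_ne ?_ (Ne.symm h0)
      rw [← hq, dotProduct]
      exact Finset.sum_nonneg fun i _ => mul_self_nonneg _
    have : IsProbabilityMeasure (m.map Φ) := Measure.isProbabilityMeasure_map hΦ.aemeasurable
    -- Near a point of the support of the law of `Φ`, two typical values have squared distance below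
    -- `2 (δ/4) + 2 (δ/4) = δ`.
    obtain ⟨v, -, hv⟩ := exists_mem_forall_mem_nhdsWithin_pos_measure (μ := m.map Φ)
      (s := Set.univ) (by simp)
    set t : Set (Fin d → ℝ) := {w | (w - v) ⬝ᵥ (w - v) < δ / 4} with ht
    have hcont : Continuous fun w : Fin d → ℝ => (w - v) ⬝ᵥ (w - v) := by
      simp only [dotProduct, Pi.sub_apply]
      fun_prop
    have hto : IsOpen t := isOpen_lt hcont continuous_const
    have htv : v ∈ t := by simp [ht, hpos]
    have hE := hv t (by rw [nhdsWithin_univ]; exact hto.mem_nhds htv)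
    rw [Measure.map_apply hΦ hto.measurableSet] at hE
    have hfreq : ∃ᵐ y ∂m, Φ y ∈ t := frequently_ae_mem_iff.2 hE.ne'
    obtain ⟨y, hyt, hy⟩ := (hfreq.and_eventually hδ').exists
    obtain ⟨z, hzt, hz⟩ := (hfreq.and_eventually hy).exists
    have hle : (Φ y - Φ z) ⬝ᵥ (Φ y - Φ z)
        ≤ 2 * ((Φ y - v) ⬝ᵥ (Φ y - v)) + 2 * ((Φ z - v) ⬝ᵥ (Φ z - v)) := by
      simp only [dotProduct, Pi.sub_apply, Finset.mul_sum, ← Finset.sum_add_distrib]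
      exact Finset.sum_le_sum fun i _ => by nlinarith [sq_nonneg (Φ y i + Φ z i - 2 * v i)]
    simp only [ht, Set.mem_ofPred_eq] at hyt hzt
    simp only at hz
    linarith

end Ergodicity

/-! ### Equivariance of the disintegration; the fibered product measure. -/

section Disintegration

open Filter Topology Function

variable {G X X' : Type*} [Group G] [MeasurableSpace X] [MeasurableSpace X']
  [StandardBorelSpace X'] {μ : Measure X} {μ' : Measure X'} [IsProbabilityMeasure μ']
  {p : X' → X}

instance isMarkovKernel_disintegration : IsMarkovKernel (disintegration μ' p) := by
  unfold disintegration
  infer_instance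

theorem compProd_disintegration (hp : MeasurePreserving p μ' μ) :
    μ ⊗ₘ disintegration μ' p = μ'.map fun y => (p y, y) := by
  have : Nonempty X' := nonempty_of_isProbabilityMeasure μ'
  rw [← hp.map_eq]
  exact compProd_map_condDistrib (Y := id) aemeasurable_id

/-- The composition-product of `μ` with the disintegration is the law of `(p y, y)`, so fibrewise
statements transfer to `X'` along the graph of `p`. -/
theorem ae_ae_disintegration_iff [IsProbabilityMeasure μ] (hp : MeasurePreserving p μ' μ)
    {Q : X × X' → Prop} (hQ : MeasurableSet {q | Q q}) :
    (∀ᵐ x ∂μ, ∀ᵐ y ∂disintegration μ' p x, Q (x, y)) ↔ ∀ᵐ y ∂μ', Q (p y, y) := by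
  rw [← Measure.ae_compProd_iff hQ, compProd_disintegration hp,
    ae_map_iff (hp.measurable.prodMk measurable_id').aemeasurable hQ]

/-- Uniqueness of disintegration: pulling the fibre measure over `g • x` back by `g⁻¹` also
disintegrates `μ'`, as is checked on rectangles. -/
theorem ae_disintegration_smul [StandardBorelSpace X] [IsProbabilityMeasure μ] [MulAction G X]
    [MulAction G X'] [MeasurableConstSMul G X] [MeasurableConstSMul G X']
    [SMulInvariantMeasure G X μ] [SMulInvariantMeasure G X' μ'] (hp : IsExtension G μ' μ p)
    (g : G) :
    ∀ᵐ x ∂μ, disintegration μ' p (g • x) = (disintegration μ' p x).map (g • ·) := by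
  have hm := hp.measurePreserving
  have hg : Measurable (g • · : X → X) := measurable_const_smul g
  have hg' : Measurable (g⁻¹ • · : X' → X') := measurable_const_smul g⁻¹
  have hκ : ∀ {s : Set X} {t : Set X'}, MeasurableSet s → MeasurableSet t →
      (μ ⊗ₘ disintegration μ' p) (s ×ˢ t) = μ' (p ⁻¹' s ∩ t) := fun hs ht => by
    rw [compProd_disintegration hm,
      Measure.map_apply (hm.measurable.prodMk measurable_id') (hs.prod ht)]
    rfl
  have key : μ ⊗ₘ disintegration μ' p
      = μ ⊗ₘ ((disintegration μ' p).comap (g • ·) hg).map (g⁻¹ • ·) := by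
    have : IsMarkovKernel (((disintegration μ' p).comap (g • ·) hg).map (g⁻¹ • ·)) :=
      Kernel.IsMarkovKernel.map _ hg'
    refine Measure.ext_prod fun {s t} hs ht => ?_
    have hs' : MeasurableSet ((g⁻¹ • · : X → X) ⁻¹' s) := measurable_const_smul g⁻¹ hs
    have hpre : s = (g • · : X → X) ⁻¹' ((g⁻¹ • · : X → X) ⁻¹' s) := by
      ext x
      simp
    rw [hκ hs ht, Measure.compProd_apply_prod hs ht]
    simp only [Kernel.map_apply' _ hg' _ ht, Kernel.comap_apply]
    conv_rhs => rw [hpre]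
    rw [(measurePreserving_smul g μ).setLIntegral_comp_preimage hs'
      ((disintegration μ' p).measurable_coe (hg' ht)),
      ← Measure.compProd_apply_prod hs' (hg' ht), hκ hs' (hg' ht),
      ← measure_preimage_smul μ' g⁻¹ (p ⁻¹' s ∩ t)]
    refine measure_congr ?_
    filter_upwards [hp.equivariant g⁻¹] with y hy
    refine propext ?_
    change p (g⁻¹ • y) ∈ s ∧ g⁻¹ • y ∈ t ↔ g⁻¹ • p y ∈ s ∧ g⁻¹ • y ∈ t
    rw [hy]
  have : IsMarkovKernel (((disintegration μ' p).comap (g • ·) hg).map (g⁻¹ • ·)) :=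
    Kernel.IsMarkovKernel.map _ hg'
  filter_upwards [Kernel.ae_eq_of_compProd_eq key] with x hx
  rw [hx, Kernel.map_apply _ hg', Kernel.comap_apply,
    Measure.map_map (measurable_const_smul g) hg']
  simp [comp_def]

theorem ergodicFibration_disintegration [StandardBorelSpace X] [IsProbabilityMeasure μ]
    [MulAction G X] [MulAction G X'] [MeasurableConstSMul G X] [MeasurableConstSMul G X']
    [SMulInvariantMeasure G X μ] [ErgodicSMul G X' μ'] (hp : IsExtension G μ' μ p) :
    ErgodicFibration G μ (disintegration μ' p) := by
  have hm := hp.measurePreserving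
  refine ⟨ae_disintegration_smul hp, fun r hr hinv => ?_⟩
  obtain ⟨c, hc⟩ := ErgodicSMul.ae_const_of_ae_invariant (G := G) (m := μ')
    (r := fun y => r (p y) y) (hr.comp (hm.measurable.prodMk measurable_id)) fun g => by
      have h1 := (ae_ae_disintegration_iff hm
        (Q := fun q => r (g • q.1) (g • q.2) = r q.1 q.2) (measurableSet_eq_fun
          (hr.comp (f := fun q : X × X' => (g • q.1, g • q.2)) (by fun_prop)) hr)).1 (hinv g)
      filter_upwards [h1, hp.equivariant g] with y h2 h3
      rw [h3]
      exact h2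
  exact ⟨c, (ae_ae_disintegration_iff hm (Q := fun q => r q.1 q.2 = c)
    (measurableSet_eq_fun hr measurable_const)).2 hc⟩

theorem fiberedProductMeasure_apply {s : Set (X' × X')} (hs : MeasurableSet s) :
    fiberedProductMeasure μ' μ p s
      = ∫⁻ x, ((disintegration μ' p x).prod (disintegration μ' p x)) s ∂μ := by
  have : (fun x => (disintegration μ' p x).prod (disintegration μ' p x))
      = ⇑(disintegration μ' p ×ₖ disintegration μ' p) := by
    funext x
    rw [Kernel.prod_apply]
  rw [fiberedProductMeasure, this, Measure.bind_apply hs (Kernel.aemeasurable _), ← this]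

theorem ae_fiberedProductMeasure_iff {Q : X' × X' → Prop} (hQ : MeasurableSet {q | Q q}) :
    (∀ᵐ q ∂fiberedProductMeasure μ' μ p, Q q) ↔
      ∀ᵐ x ∂μ, ∀ᵐ y ∂disintegration μ' p x, ∀ᵐ z ∂disintegration μ' p x, Q (y, z) := by
  have hm : Measurable fun x =>
      ((disintegration μ' p x).prod (disintegration μ' p x)) {q | Q q}ᶜ := by
    simp only [← Kernel.prod_apply]
    exact Kernel.measurable_coe _ hQ.compl
  rw [ae_iff, show {q | ¬ Q q} = {q | Q q}ᶜ from rfl, fiberedProductMeasure_apply hQ.compl,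
    lintegral_eq_zero_iff hm]
  refine eventually_congr (Eventually.of_forall fun x => ?_)
  exact Measure.measure_prod_null hQ.compl

theorem smulInvariantMeasure_fiberedProductMeasure [StandardBorelSpace X]
    [IsProbabilityMeasure μ] [MulAction G X]
    [MulAction G X'] [MeasurableConstSMul G X] [MeasurableConstSMul G X']
    [SMulInvariantMeasure G X μ] [SMulInvariantMeasure G X' μ'] (hp : IsExtension G μ' μ p) :
    SMulInvariantMeasure G (X' × X') (fiberedProductMeasure μ' μ p) := by
  refine ⟨fun g s hs => ?_⟩
  have hg : Measurable (g • · : X' → X') := measurable_const_smul g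
  have hgg : Measurable (g • · : X' × X' → X' × X') := hg.prodMap hg
  have hm : Measurable fun x => ((disintegration μ' p x).prod (disintegration μ' p x)) s := by
    simp only [← Kernel.prod_apply]
    exact Kernel.measurable_coe _ hs
  rw [fiberedProductMeasure_apply (hgg hs), fiberedProductMeasure_apply hs,
    ← (measurePreserving_smul g μ).lintegral_comp hm]
  refine lintegral_congr_ae ?_
  filter_upwards [ae_disintegration_smul hp g] with x hx
  rw [hx, Measure.map_prod_map _ _ hg hg, Measure.map_apply (hg.prodMap hg) hs]
  rfl

end Disintegration

/-! ### The contradiction and the main theorem. -/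

section RelativeWeakMixing

open Filter Topology Function Matrix

variable {G X X' : Type*}
    [Group G] [MeasurableSpace G] [MeasurableSpace X] [StandardBorelSpace X] [MulAction G X]
    [MeasurableSMul₂ G X] {μ : Measure X} [IsProbabilityMeasure μ] [SMulInvariantMeasure G X μ]
    [MeasurableSpace X'] [StandardBorelSpace X'] [MulAction G X'] [MeasurableSMul₂ G X']
    {μ' : Measure X'} [IsProbabilityMeasure μ'] [SMulInvariantMeasure G X' μ'] {p : X' → X}

/-- If `X` is superrigid and `X'` is weakly mixing, an invariant symmetric family of kernels on the
fibres of `X' → X` which annihilates the constants vanishes. -/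
theorem ae_eq_zero_of_isInvariantKernel (hX : IsCompactCocycleSuperrigid G μ)
    (hp : IsExtension G μ' μ p) (hX' : IsWeaklyMixing G μ') {T : X → X' → X' → ℝ}
    (hTm : Measurable fun q : X × X' × X' => T q.1 q.2.1 q.2.2)
    (hTb : ∀ x, IsBddMeas (uncurry (T x))) (hTs : ∀ x y z, T x y z = T x z y)
    (hTi : IsInvariantKernel G μ (disintegration μ' p) T)
    (hT1 : ∀ᵐ x ∂μ, ∀ᵐ y ∂disintegration μ' p x, ∫ z, T x y z ∂disintegration μ' p x = 0) :
    ∀ᵐ x ∂μ, ∀ᵐ y ∂disintegration μ' p x, ∀ᵐ z ∂disintegration μ' p x, T x y z = 0 := by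
  by_contra hT0
  have : ErgodicSMul G X' μ' := hX'.ergodicSMul
  have hm := hp.measurePreserving
  have hE : ErgodicFibration G μ (disintegration μ' p) := ergodicFibration_disintegration hp
  set κ := disintegration μ' p
  obtain ⟨P, t, hPm, hPb, hPs, hPi, hPP, ht, hPt, hP1⟩ :=
    exists_invariant_projection hE hTm hTb hTs hTi hT0 hT1
  obtain ⟨N, hN⟩ := exists_nat_gt t
  obtain ⟨d, f, hfm, hfb, hf⟩ := exists_orthonormal_frame N hN hPm hPb hPs hPP (by
    filter_upwards [hPt] with x hx
    rw [integral_congr_ae hx]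
    simp)
  have hfP := hf.mono fun x hx => hx.2
  obtain ⟨φ, ρ, hφm, hφ, hρ, hfφ⟩ := exists_equivariant_frame hX hE hPi hfm hfb
    (hf.mono fun x hx => hx.1) hfP
  have hFm : ∀ i, Measurable fun q : X × X' => ((φ q.1)ᵀ *ᵥ fun i => f i q.1 q.2) i := by
    intro i
    simp only [Matrix.mulVec, dotProduct, Matrix.transpose_apply]
    exact Finset.measurable_sum _ fun j _ => ((hφm j i).comp measurable_fst).mul (hfm j)
  have hFm' : Measurable fun q : X × X' => (φ q.1)ᵀ *ᵥ fun i => f i q.1 q.2 :=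
    measurable_pi_iff.2 hFm
  have hρm : ∀ g, Measurable fun v : Fin d → ℝ => ρ g *ᵥ v := fun g =>
    (Continuous.matrix_mulVec continuous_const continuous_id).measurable
  obtain ⟨v, hv⟩ := hX'.ae_const_of_orthogonal
    (Φ := fun y => (φ (p y))ᵀ *ᵥ fun i => f i (p y) y)
    (hFm'.comp (hm.measurable.prodMk measurable_id')) hρ fun g => by
      have h1 := (ae_ae_disintegration_iff hm (Q := fun q =>
        (φ (g • q.1))ᵀ *ᵥ (fun i => f i (g • q.1) (g • q.2))
          = ρ g *ᵥ ((φ q.1)ᵀ *ᵥ fun i => f i q.1 q.2))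
        (measurableSet_eq_fun
          (hFm'.comp (f := fun q : X × X' => (g • q.1, g • q.2)) (by fun_prop))
          ((hρm g).comp hFm'))).1 (hfφ g)
      filter_upwards [h1, hp.equivariant g] with y h2 h3
      rw [h3]
      exact h2
  have hv' := (ae_ae_disintegration_iff hm
    (Q := fun q => (φ q.1)ᵀ *ᵥ (fun i => f i q.1 q.2) = v)
    (measurableSet_eq_fun hFm' measurable_const)).2 hv
  obtain ⟨x, h1, h2, h3, h4⟩ := (hv'.and (hfP.and (hPt.and hP1))).exists
  -- Undoing the rotation shows that the frame is constant on the fibre. Hence so is `P`, whose zero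
  -- row integral then contradicts its row norm `t > 0`.
  have h5 : ∀ᵐ y ∂κ x, (fun i => f i x y) = φ x *ᵥ v := by
    filter_upwards [h1] with y hy
    rw [← hy, Matrix.mulVec_mulVec, hφ, Matrix.one_mulVec]
  obtain ⟨y, a1, a2, a3, a4⟩ := (h5.and (h2.and (h3.and h4))).exists
  have h6 : ∀ᵐ z ∂κ x, P x y z = ∑ i, (φ x *ᵥ v) i * (φ x *ᵥ v) i := by
    filter_upwards [a2, h5] with z b1 b2
    rw [b1]
    exact Finset.sum_congr rfl fun i _ => congrArg₂ _ (congrFun a1 i) (congrFun b2 i)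
  have h7 : ∑ i, (φ x *ᵥ v) i * (φ x *ᵥ v) i = 0 := by
    rw [← a4, integral_congr_ae h6]
    simp
  rw [integral_congr_ae (h6.mono fun z hz => by rw [hz, h7])] at a3
  simp at a3
  exact ht.ne a3

/-- Weakly mixing extensions of superrigid actions are relatively weakly mixing. -/
theorem relativelyWeaklyMixing_of_superrigid (hX : IsCompactCocycleSuperrigid G μ)
    (hp : IsExtension G μ' μ p) (hX' : IsWeaklyMixing G μ') :
    IsRelativelyWeaklyMixing G μ' μ p := by
  have : ErgodicSMul G X' μ' := hX'.ergodicSMul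
  have hE : ErgodicFibration G μ (disintegration μ' p) := ergodicFibration_disintegration hp
  have hinvm := smulInvariantMeasure_fiberedProductMeasure hp
  have hφ : ∀ g : G, Measurable (g • · : X' → X') := fun g => measurable_const_smul g
  refine { toSMulInvariantMeasure := hinvm, aeconst_of_forall_preimage_smul_ae_eq := ?_ }
  intro s hs hinv
  set κ := disintegration μ' p with hκ
  set a : X' → X' → ℝ := fun y z => s.indicator (fun _ => (1 : ℝ)) (y, z) with ha
  have hab : IsBddMeas (uncurry a) := IsBddMeas.indicator hs
  have hai : ∀ g : G, ∀ᵐ x ∂μ, ∀ᵐ y ∂κ x, ∀ᵐ z ∂κ x, a (g • y) (g • z) = a y z := by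
    intro g
    refine (ae_fiberedProductMeasure_iff (μ := μ)
      (Q := fun q => a (g • q.1) (g • q.2) = a q.1 q.2) (measurableSet_eq_fun
        (hab.1.comp (f := fun q : X' × X' => (g • q.1, g • q.2)) (by fun_prop)) hab.1)).1 ?_
    filter_upwards [hinv g] with q hq
    have hq' : g • q ∈ s ↔ q ∈ s := iff_of_eq hq
    change s.indicator (fun _ => (1 : ℝ)) (g • q) = s.indicator (fun _ => (1 : ℝ)) q
    by_cases h : q ∈ s
    · rw [Set.indicator_of_mem h, Set.indicator_of_mem (hq'.2 h)]
    · rw [Set.indicator_of_notMem h, Set.indicator_of_notMem (fun h' => h (hq'.1 h'))]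
  -- The fibre measure of the section of `s` through `y` is an invariant function of `y`.
  obtain ⟨c, hc⟩ := hE.ae_const (fun x y => ∫ z, a y z ∂κ x)
    (measurable_integral_fiber (u := fun (q : X × X') z => a q.2 z) measurable_fst
      (hab.1.comp (f := fun r : (X × X') × X' => (r.1.2, r.2)) (by fun_prop)))
    fun g => by
      filter_upwards [hE.map_smul g, hai g] with x h1 h2
      filter_upwards [h2] with y h3
      rw [h1, integral_map (hφ g).aemeasurable (hab.row _).1.aestronglyMeasurable]
      exact integral_congr_ae h3
  set K : X' → X' → ℝ := fun y z => a y z - c with hK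
  have hKb : IsBddMeas (uncurry K) := hab.sub (.const c)
  have hKi : ∀ g : G, ∀ᵐ x ∂μ, ∀ᵐ y ∂κ x, ∀ᵐ z ∂κ x, K (g • y) (g • z) = K y z := fun g => by
    filter_upwards [hai g] with x h1
    filter_upwards [h1] with y h2
    filter_upwards [h2] with z h3
    simp only [hK, h3]
  have hK1 : ∀ᵐ x ∂μ, ∀ᵐ y ∂κ x, ∫ z, K y z ∂κ x = 0 := by
    filter_upwards [hc] with x h1
    filter_upwards [h1] with y h2
    simp only [hK]
    rw [integral_sub ((hab.row y).integrable _) (integrable_const _), h2]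
    simp
  -- `K` need not be symmetric, so the vanishing theorem is applied to `KᵀK`, which is symmetric and
  -- inherits invariance and the annihilation of constants.
  have hT := ae_eq_zero_of_isInvariantKernel hX hp hX'
    (T := fun x => kcomp (κ x) (fun y z => K z y) K)
    (measurable_kcomp_fiber (a := fun _ y z => K z y) (b := fun _ => K)
      (hKb.swap.1.comp measurable_snd) (hKb.1.comp measurable_snd))
    (fun x => hKb.swap.kcomp _ hKb)
    (fun x y z => by simp only [kcomp, mul_comm])
    (fun g => by
      filter_upwards [hE.map_smul g, hKi g] with x h1 h2
      rw [h1]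
      refine kcomp_map (hφ g) hKb.swap hKb hKb ?_ h2
      exact ae_ae_swap_of_measurable (u := fun y z => K (g • y) (g • z)) (v := K)
        (hKb.1.comp (f := fun q : X' × X' => (g • q.1, g • q.2)) (by fun_prop)) hKb.1 h2)
    (by
      filter_upwards [hK1] with x h1
      refine Eventually.of_forall fun y => ?_
      have h2 := congrFun (congrFun (kcomp_assoc (κ x) hKb.swap hKb
        (c := fun _ _ => (1 : ℝ)) (.const 1)) y) y
      have h3 : ∀ b : X' → X' → ℝ, ∀ y, kcomp (κ x) b (fun _ _ => (1 : ℝ)) y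
          = fun _ => ∫ z, b y z ∂κ x := fun b y => by
        funext w
        simp only [kcomp, mul_one]
      rw [h3] at h2
      refine h2.trans ?_
      refine integral_eq_zero_of_ae ?_
      filter_upwards [h1] with w hw
      rw [h3]
      simp [hw])
  have hK0 : ∀ᵐ q ∂fiberedProductMeasure μ' μ p, uncurry a q = c := by
    refine (ae_fiberedProductMeasure_iff (measurableSet_eq_fun hab.1 measurable_const)).2 ?_
    filter_upwards [hT] with x hx
    filter_upwards [ae_eq_zero_of_transpose_kcomp_self _ hKb hx] with y hy
    filter_upwards [hy] with z hz
    exact sub_eq_zero.1 hz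
  rw [eventuallyConst_set]
  by_cases h1 : c = 1
  · left
    filter_upwards [hK0] with q hq
    by_contra hqs
    have : uncurry a q = 0 := Set.indicator_of_notMem hqs fun _ => (1 : ℝ)
    rw [hq, h1] at this
    exact one_ne_zero this
  · right
    filter_upwards [hK0] with q hq hqs
    have : uncurry a q = 1 := Set.indicator_of_mem hqs fun _ => (1 : ℝ)
    exact h1 (hq.symm.trans this)

end RelativeWeakMixing

theorem proposition1p12 {G X X' : Type*}
    [Group G] [TopologicalSpace G] [IsTopologicalGroup G] [LocallyCompactSpace G] [T2Space G]
    [SecondCountableTopology G] [MeasurableSpace G] [BorelSpace G]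
    [MeasurableSpace X] [StandardBorelSpace X] [MulAction G X] [MeasurableSMul₂ G X]
    (μ : Measure X) [IsProbabilityMeasure μ] [SMulInvariantMeasure G X μ]
    [MeasurableSpace X'] [StandardBorelSpace X'] [MulAction G X'] [MeasurableSMul₂ G X']
    (μ' : Measure X') [IsProbabilityMeasure μ'] [SMulInvariantMeasure G X' μ']
    (hX : IsCompactCocycleSuperrigid G μ)
    (p : X' → X) (hp : IsExtension G μ' μ p)
    (hX' : IsWeaklyMixing G μ') :
    IsRelativelyWeaklyMixing G μ' μ p :=
  relativelyWeaklyMixing_of_superrigid hX hp hX'
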